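/- Let $\mathbb P^*$ be a Borel probability measure on $\mathbb R^d$ supported in a known finite box $[\mathbf a,\mathbf b]=\{\mathbf u: a_i\le u_i\le b_i\}$, let $0<\alpha<1$, and let $\hat{\mathbf u}^1,\dots,\hat{\mathbf u}^N$ ($N\ge1$) be an i.i.d. sample from $\mathbb P^*$, with sample mean $\hat{\boldsymbol\mu}=\frac1N\sum_j\hat{\mathbf u}^j$ and sample covariance $\hat{\boldsymbol\Sigma}=\frac1N\sum_j(\hat{\mathbf u}^j-\hat{\boldsymbol\mu})(\hat{\mathbf u}^j-\hat{\boldsymbol\mu})^T$. Whenever $\hat{\boldsymbol\Sigma}$ is invertible, let $\mathbf C$ be any matrix with $\mathbf C^T\mathbf C=\hat{\boldsymbol\Sigma}^{-1}$ (for instance a Cholesky factor). For thresholds $\gamma_1,\gamma_2\ge0$ let $$\mathcal P^{DY}=\{\mathbb P : \mathbb P([\mathbf a,\mathbf b])=1,\ (\mathbb E^{\mathbb P}[\tilde{\mathbf u}]-\hat{\boldsymbol\mu})^T\hat{\boldsymbol\Sigma}^{-1}(\mathbb E^{\mathbb P}[\tilde{\mathbf u}]-\hat{\boldsymbol\mu})\le\gamma_1,\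 \mathbb E^{\mathbb P}[(\tilde{\mathbf u}-\hat{\boldsymbol\mu})(\tilde{\mathbf u}-\hat{\boldsymbol\mu})^T]\preceq\gamma_2\hat{\boldsymbol\Sigma}\},$$ where $\mathbb P$ ranges over Borel probability measures on $\mathbb R^d$. For $0<\epsilon<1$ let $\mathcal U^{DY}_\epsilon$ be the set of $\mathbf u\in[\mathbf a,\mathbf b]$ for which there are $\lambda\in\mathbb R$, $\mathbf w,\mathbf m\in\mathbb R^d$ and $\mathbf A,\hat{\mathbf A}\succeq\mathbf 0$ with $$\lambda\le\tfrac1\epsilon,\quad(\lambda-1)\mathbf a\le\mathbf m\le(\lambda-1)\mathbf b,\quad\begin{pmatrix}\lambda-1&\mathbf m^T\\\mathbf m&\mathbf A\end{pmatrix}\succeq\mathbf 0,\quad\begin{pmatrix}1&\mathbf u^T\\\mathbf u&\hat{\mathbf A}\end{pmatrix}\succeq\mathbf 0,$$ $$\lambda\hat{\boldsymbol\mu}=\mathbf m+\mathbf u+\mathbf w,\quad\|\mathbf C\mathbf w\|_2\le\lambda\sqrt{\gamma_1},\quad\lambda(\gamma_2\hat{\boldsymbol\Sigma}+\hat{\boldsymbol\mu}\hat{\boldsymbol\mu}^T)-\mathbf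 A-\hat{\mathbf A}-\mathbf w\hat{\boldsymbol\mu}^T-\hat{\boldsymbol\mu}\mathbf w^T\succeq\mathbf 0.$$ A family $\{\mathcal U_\epsilon:0<\epsilon<1\}$ simultaneously implies a probabilistic guarantee for $\mathbb P^*$ if for all $0<\epsilon<1$, all $k$, every $f:\mathbb R^d\times\mathbb R^k\to\mathbb R$ with $f(\cdot,\mathbf x)$ concave for all $\mathbf x$, and every $\mathbf x^*$: if $f(\mathbf u,\mathbf x^*)\le0$ for all $\mathbf u\in\mathcal U_\epsilon$, then $\mathbb P^*(f(\tilde{\mathbf u},\mathbf x^*)\le0)\ge1-\epsilon$. The Value at Risk is $\mathrm{VaR}^{\mathbb P}_\epsilon(\mathbf v)=\inf\{t:\mathbb P(\tilde{\mathbf u}^T\mathbf v\le t)\ge1-\epsilon\}$. (1) Let $\gamma_1,\gamma_2\ge0$ be thresholds, possibly random (computed from the sample and further randomness, for example by the bootstrap), that are valid at level $\alpha$: with probability at least $1-\alpha$, $\hat{\boldsymbol\Sigma}$ is invertible and the true mean $\boldsymbol\mu$ and covariance $\boldsymbol\Sigma$ of $\mathbb P^*$ are not rejected, i.e. $(\hat{\boldsymbol\mu}-\boldsymbol\mu)^T\hat{\boldsymbol\Sigma}^{-1}(\hat{\boldsymbol\mu}-\boldsymbol\mu)\le\gamma_1$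 and $\max_{\boldsymbol\ell}\frac{\boldsymbol\ell^T(\boldsymbol\Sigma+(\boldsymbol\mu-\hat{\boldsymbol\mu})(\boldsymbol\mu-\hat{\boldsymbol\mu})^T)\boldsymbol\ell}{\boldsymbol\ell^T\hat{\boldsymbol\Sigma}\boldsymbol\ell}\le\gamma_2$. Then with probability at least $1-\alpha$, $\hat{\boldsymbol\Sigma}$ is invertible and $\{\mathcal U^{DY}_\epsilon:0<\epsilon<1\}$ simultaneously implies a probabilistic guarantee for $\mathbb P^*$. (2) The conclusion of (1) holds, with no assumption on the test, for the Delage–Ye thresholds $\gamma_1=\frac{\beta_2}{1-\beta_1-\beta_2}$, $\gamma_2=\frac{1+\beta_2}{1-\beta_1-\beta_2}$, where $\beta_2=\frac{R^2}{N}(2+\sqrt{2\log(2/\alpha)})^2$ and $\beta_1=\frac{R^2}{\sqrt N}\left(\sqrt{1-d/R^4}+\sqrt{\log(4/\alpha)}\right)$, provided that $\boldsymbol\Sigma$ is invertible, $\mathbb P^*((\tilde{\mathbf u}-\boldsymbol\mu)^T\boldsymbol\Sigma^{-1}(\tilde{\mathbf u}-\boldsymbol\mu)\le R^2)=1$ and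 $1-\beta_1-\beta_2>0$. (3) Almost surely, if $\hat{\boldsymbol\Sigma}$ is invertible, then for all $\gamma_1,\gamma_2\ge0$, $0<\epsilon<1$ and $\mathbf v\in\mathbb R^d$ the following three quantities are finite and equal: $$\sup_{\mathbf u\in\mathcal U^{DY}_\epsilon}\mathbf v^T\mathbf u\;=\;\sup_{\mathbb P\in\mathcal P^{DY}}\mathrm{VaR}^{\mathbb P}_\epsilon(\mathbf v)\;=\;\inf t,$$ the infimum being over all $t,r,s,\theta\in\mathbb R$, $\mathbf q,\mathbf y_1,\mathbf y_1^\pm,\mathbf y_2,\mathbf y_2^\pm\in\mathbb R^d$, $\mathbf Z\in\mathbb R^{d\times d}$ with $r+s\le\theta\epsilon$, $$\begin{pmatrix}r+\mathbf y_1^{+T}\mathbf a-\mathbf y_1^{-T}\mathbf b&\frac12(\mathbf q-\mathbf y_1)^T\\\frac12(\mathbf q-\mathbf y_1)&\mathbf Z\end{pmatrix}\succeq\mathbf 0,\quad\begin{pmatrix}r+\mathbf y_2^{+T}\mathbf a-\mathbf y_2^{-T}\mathbf b+t-\theta&\frac12(\mathbf q-\mathbf y_2-\mathbf v)^T\\\frac12(\mathbf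 q-\mathbf y_2-\mathbf v)&\mathbf Z\end{pmatrix}\succeq\mathbf 0,$$ $$s\ge\operatorname{tr}\big((\gamma_2\hat{\boldsymbol\Sigma}+\hat{\boldsymbol\mu}\hat{\boldsymbol\mu}^T)^T\mathbf Z\big)+\hat{\boldsymbol\mu}^T\mathbf q+\sqrt{\gamma_1}\sqrt{(\mathbf q+2\mathbf Z\hat{\boldsymbol\mu})^T\hat{\boldsymbol\Sigma}(\mathbf q+2\mathbf Z\hat{\boldsymbol\mu})},$$ $\mathbf y_1=\mathbf y_1^+-\mathbf y_1^-$, $\mathbf y_2=\mathbf y_2^+-\mathbf y_2^-$ and $\mathbf y_1^\pm,\mathbf y_2^\pm,\theta\ge\mathbf 0$. -/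

import Mathlib

open MeasureTheory ProbabilityTheory Matrix

noncomputable section

namespace DY

variable {d N : ℕ}

/-- The vector of expectations `E^P[ũ]` of a random vector with law `P`. -/
def meanVec (P : Measure (Fin d → ℝ)) : Fin d → ℝ := fun i => ∫ u, u i ∂P

/-- The matrix `E^P[(ũ - c)(ũ - c)ᵀ]` of second moments about the point `c`. -/
def momentAbout (P : Measure (Fin d → ℝ)) (c : Fin d → ℝ) : Matrix (Fin d) (Fin d) ℝ :=
  Matrix.of fun i j => ∫ u, (u i - c i) * (u j - c j) ∂P

/-- The covariance matrix of `P`. -/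
def covMat (P : Measure (Fin d → ℝ)) : Matrix (Fin d) (Fin d) ℝ := momentAbout P (meanVec P)

/-- The mean of the sample `x 0, …, x (N-1)`. -/
def sampleMean (x : Fin N → Fin d → ℝ) : Fin d → ℝ := (N : ℝ)⁻¹ • ∑ j, x j

/-- The covariance matrix of the sample, i.e. of its empirical distribution. -/
def sampleCov (x : Fin N → Fin d → ℝ) : Matrix (Fin d) (Fin d) ℝ :=
  (N : ℝ)⁻¹ • ∑ j, vecMulVec (x j - sampleMean x) (x j - sampleMean x)

/-- Value at Risk: `inf {t : P(ũᵀv ≤ t) ≥ 1 - ε}`. -/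
def VaR (ε : ℝ) (P : Measure (Fin d → ℝ)) (v : Fin d → ℝ) : ℝ :=
  sInf {t : ℝ | 1 - ε ≤ P.real {u | u ⬝ᵥ v ≤ t}}

/-- `U` implies a probabilistic guarantee for `P` at level `ε`: for every dimension `k`, every
`f(u, x)` that is concave in `u` for all `x`, and every `xs`, if `f(u, xs) ≤ 0` on all of `U`, then
`P(f(ũ, xs) ≤ 0) ≥ 1 - ε`. -/
def ImpliesGuarantee (U : Set (Fin d → ℝ)) (ε : ℝ) (P : Measure (Fin d → ℝ)) : Prop :=
  ∀ (k : ℕ) (f : (Fin d → ℝ) → (Fin k → ℝ) → ℝ),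
    (∀ x, ConcaveOn ℝ Set.univ (fun u => f u x)) →
    ∀ xs : Fin k → ℝ, (∀ u ∈ U, f u xs ≤ 0) → 1 - ε ≤ P.real {u | f u xs ≤ 0}

/-- The family `U ε`, `0 < ε < 1`, simultaneously implies a probabilistic guarantee for `P`. -/
def SimultaneouslyImpliesGuarantee (U : ℝ → Set (Fin d → ℝ)) (P : Measure (Fin d → ℝ)) : Prop :=
  ∀ ε : ℝ, 0 < ε → ε < 1 → ImpliesGuarantee (U ε) ε P

/-- `S` holds with probability at least `p`: it holds on some event of probability at least `p`. -/
def HoldsWithProbAtLeast {Ω : Type*} [MeasurableSpace Ω] (Q : Measure Ω) (p : ℝ)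
    (S : Ω → Prop) : Prop :=
  ∃ E : Set Ω, MeasurableSet E ∧ ENNReal.ofReal p ≤ Q E ∧ ∀ ω ∈ E, S ω

/-- The test statistic `(μ̂ - μ₀)ᵀ Σ̂⁻¹ (μ̂ - μ₀)` for the mean. -/
def meanStat (muHat : Fin d → ℝ) (SigHat : Matrix (Fin d) (Fin d) ℝ) (mu0 : Fin d → ℝ) : ℝ :=
  (muHat - mu0) ⬝ᵥ (SigHat⁻¹ *ᵥ (muHat - mu0))

/-- The test statistic `max_l lᵀ(Σ₀ + (μ₀ - μ̂)(μ₀ - μ̂)ᵀ)l / lᵀΣ̂l` for the covariance. For positive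
definite `Σ̂` and positive semidefinite `Σ₀` all quotients are nonnegative and bounded, and `l = 0`
contributes the harmless value `0`. -/
def covStat (muHat : Fin d → ℝ) (SigHat : Matrix (Fin d) (Fin d) ℝ) (mu0 : Fin d → ℝ)
    (Sig0 : Matrix (Fin d) (Fin d) ℝ) : ℝ :=
  ⨆ l : Fin d → ℝ,
    (l ⬝ᵥ ((Sig0 + vecMulVec (mu0 - muHat) (mu0 - muHat)) *ᵥ l)) / (l ⬝ᵥ (SigHat *ᵥ l))

/-- On the sample `x`, the test with thresholds `γ₁, γ₂` is defined (that is, `Σ̂` is invertible)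
and does not reject the hypothesis that the mean is `mu0` and the covariance is `Sig0`. -/
def TestAccepts (x : Fin N → Fin d → ℝ) (γ₁ γ₂ : ℝ) (mu0 : Fin d → ℝ)
    (Sig0 : Matrix (Fin d) (Fin d) ℝ) : Prop :=
  (sampleCov x).PosDef ∧ meanStat (sampleMean x) (sampleCov x) mu0 ≤ γ₁ ∧
    covStat (sampleMean x) (sampleCov x) mu0 Sig0 ≤ γ₂

/-- The confidence region `P^DY`: Borel probability measures on the box `[a, b]` with
`(E[ũ] - μ̂)ᵀ Σ̂⁻¹ (E[ũ] - μ̂) ≤ γ₁` and `E[(ũ - μ̂)(ũ - μ̂)ᵀ] ⪯ γ₂ Σ̂`. -/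
def PDY (a b muHat : Fin d → ℝ) (SigHat : Matrix (Fin d) (Fin d) ℝ) (γ₁ γ₂ : ℝ) :
    Set (Measure (Fin d → ℝ)) :=
  {P | IsProbabilityMeasure P ∧ (∀ᵐ u ∂P, u ∈ Set.Icc a b) ∧
    (meanVec P - muHat) ⬝ᵥ (SigHat⁻¹ *ᵥ (meanVec P - muHat)) ≤ γ₁ ∧
    (γ₂ • SigHat - momentAbout P muHat).PosSemidef}

/-- The block matrix with scalar `x` at the upper left, `mᵀ`, `m` off the diagonal, and `A`. -/
def bordered (x : ℝ) (m : Fin d → ℝ) (A : Matrix (Fin d) (Fin d) ℝ) :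
    Matrix (Unit ⊕ Fin d) (Unit ⊕ Fin d) ℝ :=
  fromBlocks (Matrix.of fun _ _ => x) (replicateRow Unit m) (replicateCol Unit m) A

/-- The Euclidean norm of a vector. -/
def euclNorm (x : Fin d → ℝ) : ℝ := ‖WithLp.toLp 2 x‖

/-- The set `U^DY_ε` described by linear matrix inequalities. -/
def UDY (a b muHat : Fin d → ℝ) (SigHat C : Matrix (Fin d) (Fin d) ℝ) (γ₁ γ₂ ε : ℝ) :
    Set (Fin d → ℝ) :=
  {u | u ∈ Set.Icc a b ∧
    ∃ (lam : ℝ) (w m : Fin d → ℝ) (A Ahat : Matrix (Fin d) (Fin d) ℝ),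
      A.PosSemidef ∧ Ahat.PosSemidef ∧
      lam ≤ 1 / ε ∧
      (lam - 1) • a ≤ m ∧ m ≤ (lam - 1) • b ∧
      (bordered (lam - 1) m A).PosSemidef ∧
      (bordered 1 u Ahat).PosSemidef ∧
      lam • muHat = m + u + w ∧
      euclNorm (C *ᵥ w) ≤ lam * √γ₁ ∧
      (lam • (γ₂ • SigHat + vecMulVec muHat muHat) - A - Ahat
        - vecMulVec w muHat - vecMulVec muHat w).PosSemidef}

/-- The values `t` that are feasible, together with some choice of the other variables, in the
semidefinite program for the worst-case Value at Risk in direction `v`. The last term in the bound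
on `s` is `√γ₁` times the norm of `q + 2 Z μ̂` that is dual to `w ↦ √(wᵀ Σ̂⁻¹ w)`. -/
def sdpValues (a b muHat : Fin d → ℝ) (SigHat : Matrix (Fin d) (Fin d) ℝ) (γ₁ γ₂ ε : ℝ)
    (v : Fin d → ℝ) : Set ℝ :=
  {t | ∃ (r s θ : ℝ) (q y₁ y₁p y₁m y₂ y₂p y₂m : Fin d → ℝ) (Z : Matrix (Fin d) (Fin d) ℝ),
      r + s ≤ θ * ε ∧
      (bordered (r + y₁p ⬝ᵥ a - y₁m ⬝ᵥ b) ((1 / 2 : ℝ) • (q - y₁)) Z).PosSemidef ∧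
      (bordered (r + y₂p ⬝ᵥ a - y₂m ⬝ᵥ b + t - θ) ((1 / 2 : ℝ) • (q - y₂ - v)) Z).PosSemidef ∧
      ((γ₂ • SigHat + vecMulVec muHat muHat)ᵀ * Z).trace + muHat ⬝ᵥ q
        + √γ₁ * √((q + (2 : ℝ) • (Z *ᵥ muHat)) ⬝ᵥ (SigHat *ᵥ (q + (2 : ℝ) • (Z *ᵥ muHat)))) ≤ s ∧
      y₁ = y₁p - y₁m ∧ y₂ = y₂p - y₂m ∧
      0 ≤ y₁p ∧ 0 ≤ y₁m ∧ 0 ≤ y₂p ∧ 0 ≤ y₂m ∧ 0 ≤ θ}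

/-- Delage and Ye's constant `β₁`. -/
def beta1 (R α : ℝ) (N d : ℕ) : ℝ :=
  R ^ 2 / √(N : ℝ) * (√(1 - (d : ℝ) / R ^ 4) + √(Real.log (4 / α)))

/-- Delage and Ye's constant `β₂`. -/
def beta2 (R α : ℝ) (N : ℕ) : ℝ :=
  R ^ 2 / (N : ℝ) * (2 + √(2 * Real.log (2 / α))) ^ 2

/-- Delage and Ye's threshold `γ₁`. -/
def gamma1 (R α : ℝ) (N d : ℕ) : ℝ := beta2 R α N / (1 - beta1 R α N d - beta2 R α N)

/-- Delage and Ye's threshold `γ₂`. -/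
def gamma2 (R α : ℝ) (N d : ℕ) : ℝ := (1 + beta2 R α N) / (1 - beta1 R α N d - beta2 R α N)

end DY

end

/-!
The set `UDY` is the projection of a system of linear matrix inequalities whose variables are
moments of order at most two. All claims rest on one observation: `u ∈ UDY` at level `ε` if and only
if some distribution in the confidence region `PDY` has `u` as its mean conditional on an event of
probability at least `ε`.

* If `P ∈ PDY` and `S` is an event with `P S ≥ ε`, the moments of `P` restricted to `S` and to its
  complement solve the inequalities with `lam = 1 / P S` (`condMean_mem_UDY`). A concave function
  that is positive with probability more than `ε` is positive at the mean conditional on that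
  event, by Jensen's inequality (`pos_condMean`). Hence `UDY` implies the guarantee for every member
  of `PDY` (`simultaneouslyImpliesGuarantee`), and a test that does not reject the mean and the
  covariance of a distribution places it in `PDY` (`mem_PDY_of_testAccepts`).

* Conversely, a solution with `lam < 1 / ε` gives a two-point distribution in `PDY` with mass
  `1 / lam > ε` at `u` (`exists_PDY_le_VaR`). Mixing a solution with the one that belongs to the
  Dirac mass at the sample mean makes `lam` smaller, so the worst-case Value at Risk is the support
  function of `UDY` (`isLUB_VaR`). This uses that the sample mean lies in the box, as it does almost
  surely.

* Weak duality with the semidefinite program is the nonnegativity of traces of products of positive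
  semidefinite matrices (`le_of_mem_sdpValues`). For strong duality (`mem_sdpValues_of_lt`), no
  Slater condition holds on the side of `UDY` when a threshold vanishes, but the variables can be
  restricted to a compact convex set, on which Sion's minimax theorem yields multipliers `Z` and `ξ`
  of the Lagrangian. What then remains is the minimization of two convex quadratic functions on the
  box, whose optimality conditions provide the other variables (`exists_box_multipliers`).

* For the thresholds of Delage and Ye, let `z` be the standardized data, with mean `0`, covariance `1`
  and norm at most `R`. McDiarmid's inequality, proved here by induction from Hoeffding's lemma
  (`integral_exp_le_of_boundedDifferences`), bounds the norm of the sample mean of `z` and the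
  Frobenius norm of the sample mean of `z zᵀ - 1` (`IsStandardized.measure_mean_le`,
  `IsStandardized.measure_secondMoment_le`). The bounds make the sample covariance at least
  `(1 - β₁ - β₂)` times the true one, which puts the true distribution in `PDY`
  (`mem_PDY_of_concentration`).
-/

namespace DY

variable {d N : ℕ}

/-! ### Positive semidefinite and bordered matrices -/

theorem posSemidef_real_iff {n : Type*} [Fintype n] {M : Matrix n n ℝ} :
    M.PosSemidef ↔ Mᵀ = M ∧ ∀ x, 0 ≤ x ⬝ᵥ (M *ᵥ x) := by
  rw [posSemidef_iff_dotProduct_mulVec]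
  rfl

theorem posDef_real_iff {n : Type*} [Fintype n] {M : Matrix n n ℝ} :
    M.PosDef ↔ Mᵀ = M ∧ ∀ x, x ≠ 0 → 0 < x ⬝ᵥ (M *ᵥ x) := by
  rw [posDef_iff_dotProduct_mulVec]
  rfl

theorem trace_mul_nonneg {n : Type*} [Fintype n] {A B : Matrix n n ℝ} (hA : A.PosSemidef)
    (hB : B.PosSemidef) : 0 ≤ (A * B).trace := by
  classical
  obtain ⟨k, D, hD⟩ := posSemidef_iff_eq_sum_vecMulVec.mp hB
  rw [hD, Finset.mul_sum, trace_sum]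
  refine Finset.sum_nonneg fun i _ => ?_
  rw [mul_vecMulVec, trace_vecMulVec, dotProduct_comm]
  exact hA.dotProduct_mulVec_nonneg _

theorem dotProduct_vecMulVec_mulVec {n : Type*} [Fintype n] (l x y : n → ℝ) :
    l ⬝ᵥ (vecMulVec x y *ᵥ l) = (x ⬝ᵥ l) * (y ⬝ᵥ l) := by
  rw [vecMulVec_mulVec, dotProduct_comm]
  simp [dotProduct_comm, mul_comm]

theorem bordered_quadForm (r : ℝ) (m : Fin d → ℝ) (A : Matrix (Fin d) (Fin d) ℝ)
    (z : Unit ⊕ Fin d → ℝ) :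
    z ⬝ᵥ (bordered r m A *ᵥ z) = z (Sum.inl ()) ^ 2 * r
      + 2 * z (Sum.inl ()) * (m ⬝ᵥ (z ∘ Sum.inr)) + (z ∘ Sum.inr) ⬝ᵥ (A *ᵥ (z ∘ Sum.inr)) := by
  rw [bordered, fromBlocks_mulVec, dotProduct, Fintype.sum_sum_type]
  simp only [Sum.elim_inl, Sum.elim_inr, Pi.add_apply, Finset.univ_unique, Finset.sum_singleton,
    mul_add, Finset.sum_add_distrib]
  have h1 : ∑ x, z (Sum.inr x) * (replicateCol Unit m *ᵥ (z ∘ Sum.inl)) x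
      = z (Sum.inl ()) * (m ⬝ᵥ (z ∘ Sum.inr)) := by
    simp [mulVec, dotProduct, Finset.mul_sum]
    exact Finset.sum_congr rfl fun _ _ => by ring
  rw [h1]
  simp [mulVec, dotProduct]
  ring

theorem bordered_transpose (r : ℝ) (m : Fin d → ℝ) (A : Matrix (Fin d) (Fin d) ℝ) :
    (bordered r m A)ᵀ = bordered r m Aᵀ := by
  ext (i | i) (j | j) <;> rfl

theorem bordered_posSemidef_iff {r : ℝ} {m : Fin d → ℝ} {A : Matrix (Fin d) (Fin d) ℝ} :
    (bordered r m A).PosSemidef ↔ Aᵀ = A ∧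
      ∀ (c : ℝ) (x : Fin d → ℝ), 0 ≤ c ^ 2 * r + 2 * c * (m ⬝ᵥ x) + x ⬝ᵥ (A *ᵥ x) := by
  rw [posSemidef_real_iff, bordered_transpose]
  refine and_congr ⟨fun h => ?_, fun h => by rw [h]⟩ ⟨fun h c x => ?_, fun h z => ?_⟩
  · exact (fromBlocks_inj.mp h).2.2.2
  · have := h (Sum.elim (fun _ => c) x)
    rw [bordered_quadForm] at this
    simpa using this
  · rw [bordered_quadForm]
    exact h _ _

theorem trace_bordered_mul (r r' : ℝ) (m m' : Fin d → ℝ) (A A' : Matrix (Fin d) (Fin d) ℝ) :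
    (bordered r m A * bordered r' m' A').trace = r * r' + 2 * (m ⬝ᵥ m') + (A * A').trace := by
  have h0 : ∀ (a : Matrix Unit Unit ℝ) (b c) (D : Matrix (Fin d) (Fin d) ℝ),
      (fromBlocks a b c D).trace = a.trace + D.trace := fun a b c D => by
    simp [trace, Fintype.sum_sum_type]
  rw [bordered, bordered, fromBlocks_multiply, h0, trace_add, trace_add]
  have h1 : (replicateRow Unit m * replicateCol Unit m').trace = m ⬝ᵥ m' := by
    simp [trace, mul_apply, dotProduct]
  have h2 : (replicateCol Unit m * replicateRow Unit m').trace = m ⬝ᵥ m' := by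
    simp [trace, mul_apply, dotProduct]
  have h3 : ((Matrix.of fun _ _ : Unit => r) * (Matrix.of fun _ _ : Unit => r')).trace
      = r * r' := by
    simp [trace, mul_apply]
  rw [h1, h2, h3]; ring

theorem bordered_smul_self_posSemidef {k : ℝ} (hk : 0 ≤ k) (x : Fin d → ℝ) :
    (bordered k (k • x) (k • vecMulVec x x)).PosSemidef := by
  rw [bordered_posSemidef_iff]
  refine ⟨by rw [transpose_smul, transpose_vecMulVec], fun c y => ?_⟩
  rw [smul_mulVec, dotProduct_smul, dotProduct_vecMulVec_mulVec, smul_dotProduct, smul_eq_mul,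
    smul_eq_mul]
  nlinarith [mul_nonneg hk (sq_nonneg (c + x ⬝ᵥ y))]

/-- Schur complement: the lower right block of a positive semidefinite bordered matrix dominates
the rank-one matrix that the border forces. -/
theorem bordered_schur {k : ℝ} {x : Fin d → ℝ} {A : Matrix (Fin d) (Fin d) ℝ}
    (h : (bordered k (k • x) A).PosSemidef) (l : Fin d → ℝ) :
    k * (x ⬝ᵥ l) ^ 2 ≤ l ⬝ᵥ (A *ᵥ l) := by
  have := (bordered_posSemidef_iff.mp h).2 (-(x ⬝ᵥ l)) l
  rw [smul_dotProduct, smul_eq_mul] at this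
  nlinarith

theorem euclNorm_sq (x : Fin d → ℝ) : euclNorm x ^ 2 = x ⬝ᵥ x := by
  rw [euclNorm, EuclideanSpace.norm_sq_eq, dotProduct]
  exact Finset.sum_congr rfl fun i _ => by simp [sq]

theorem euclNorm_nonneg (x : Fin d → ℝ) : 0 ≤ euclNorm x := norm_nonneg _

theorem abs_dotProduct_le_euclNorm (x y : Fin d → ℝ) : |x ⬝ᵥ y| ≤ euclNorm x * euclNorm y := by
  have := abs_real_inner_le_norm (WithLp.toLp 2 x) (WithLp.toLp 2 y)
  rwa [EuclideanSpace.inner_toLp_toLp, star_trivial, dotProduct_comm] at this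

theorem euclNorm_mulVec_sq {C S : Matrix (Fin d) (Fin d) ℝ} (hC : Cᵀ * C = S) (w : Fin d → ℝ) :
    euclNorm (C *ᵥ w) ^ 2 = w ⬝ᵥ (S *ᵥ w) := by
  rw [euclNorm_sq, ← hC, ← mulVec_mulVec, dotProduct_mulVec w, vecMul_transpose]

/-- If `Cᵀ C` is the inverse of an invertible `S`, then `C S Cᵀ` is the identity. -/
theorem mul_mul_transpose_eq_one {n : Type*} [Fintype n] [DecidableEq n] {C S : Matrix n n ℝ}
    (hS : IsUnit S) (hC : Cᵀ * C = S⁻¹) : C * S * Cᵀ = 1 := by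
  have h1 : (S * Cᵀ) * C = 1 := by
    rw [Matrix.mul_assoc, hC, Matrix.mul_nonsing_inv _ ((isUnit_iff_isUnit_det _).mp hS)]
  rw [Matrix.mul_assoc]
  exact mul_eq_one_comm.mp h1

theorem bordered_smul (k r : ℝ) (m : Fin d → ℝ) (A : Matrix (Fin d) (Fin d) ℝ) :
    bordered (k * r) (k • m) (k • A) = k • bordered r m A := by
  ext (i | i) (j | j) <;> rfl

theorem bordered_comb (s t r r' : ℝ) (m m' : Fin d → ℝ) (A A' : Matrix (Fin d) (Fin d) ℝ) :
    bordered (s * r + t * r') (s • m + t • m') (s • A + t • A')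
      = s • bordered r m A + t • bordered r' m' A' := by
  ext (i | i) (j | j) <;> rfl

theorem bordered_lower {r : ℝ} {m : Fin d → ℝ} {A : Matrix (Fin d) (Fin d) ℝ}
    (h : (bordered r m A).PosSemidef) : A.PosSemidef := by
  rw [bordered_posSemidef_iff] at h
  exact posSemidef_real_iff.mpr ⟨h.1, fun x => by simpa using h.2 0 x⟩

theorem bordered_corner {r : ℝ} {m : Fin d → ℝ} {A : Matrix (Fin d) (Fin d) ℝ}
    (h : (bordered r m A).PosSemidef) : 0 ≤ r := by
  rw [bordered_posSemidef_iff] at h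
  simpa using h.2 1 0

theorem posSemidef_comb {n : Type*} {A B : Matrix n n ℝ} (hA : A.PosSemidef) (hB : B.PosSemidef)
    {s t : ℝ} (hs : 0 ≤ s) (ht : 0 ≤ t) : (s • A + t • B).PosSemidef :=
  (hA.smul hs).add (hB.smul ht)

theorem trace_mul_vecMulVec (Z : Matrix (Fin d) (Fin d) ℝ) (x y : Fin d → ℝ) :
    (Z * vecMulVec x y).trace = y ⬝ᵥ (Z *ᵥ x) := by
  rw [mul_vecMulVec, trace_vecMulVec, dotProduct_comm]

theorem dotProduct_mulVec_comm {Z : Matrix (Fin d) (Fin d) ℝ} (hZ : Zᵀ = Z) (x y : Fin d → ℝ) :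
    x ⬝ᵥ (Z *ᵥ y) = y ⬝ᵥ (Z *ᵥ x) := by
  rw [dotProduct_mulVec, ← mulVec_transpose, hZ, dotProduct_comm]

theorem exists_transpose_mul_self_eq {A : Matrix (Fin d) (Fin d) ℝ} (hA : A.PosSemidef) :
    ∃ D : Matrix (Fin d) (Fin d) ℝ, Dᵀ * D = A := by
  open scoped MatrixOrder in
  obtain ⟨D, hD⟩ := CStarAlgebra.nonneg_iff_eq_star_mul_self.mp (nonneg_iff_posSemidef.mpr hA)
  exact ⟨D, hD.symm⟩

/-- The Cauchy–Schwarz inequality for the norm `w ↦ ‖C w‖` and its dual norm. -/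
theorem abs_dotProduct_le_dual {C S : Matrix (Fin d) (Fin d) ℝ} (hS : S.PosDef)
    (hC : Cᵀ * C = S⁻¹) (η w : Fin d → ℝ) :
    |η ⬝ᵥ w| ≤ √(η ⬝ᵥ (S *ᵥ η)) * euclNorm (C *ᵥ w) := by
  have hdet : IsUnit S.det := (isUnit_iff_isUnit_det _).mp hS.isUnit
  have hSt : Sᵀ = S := (posDef_real_iff.mp hS).1
  have h1 : η ⬝ᵥ w = (C *ᵥ (S *ᵥ η)) ⬝ᵥ (C *ᵥ w) := by
    rw [dotProduct_mulVec, ← mulVec_transpose, mulVec_mulVec, hC, mulVec_mulVec,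
      nonsing_inv_mul _ hdet, one_mulVec]
  have h2 : euclNorm (C *ᵥ (S *ᵥ η)) = √(η ⬝ᵥ (S *ᵥ η)) := by
    rw [← Real.sqrt_sq (euclNorm_nonneg (C *ᵥ (S *ᵥ η))), euclNorm_mulVec_sq hC, mulVec_mulVec,
      nonsing_inv_mul _ hdet, one_mulVec, dotProduct_comm]
  rw [h1, ← h2]
  exact abs_dotProduct_le_euclNorm _ _

/-- The quotients of a positive semidefinite and a positive definite quadratic form are bounded. -/
theorem exists_quadForm_le {S M : Matrix (Fin d) (Fin d) ℝ} (hS : S.PosDef)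
    (hM : M.PosSemidef) : ∃ K, ∀ l, l ⬝ᵥ (M *ᵥ l) ≤ K * (l ⬝ᵥ (S *ᵥ l)) := by
  obtain ⟨C, hC⟩ := exists_transpose_mul_self_eq hS.inv.posSemidef
  obtain ⟨k, V, hV⟩ := posSemidef_iff_eq_sum_vecMulVec.mp hM
  refine ⟨∑ i, euclNorm (C *ᵥ V i) ^ 2, fun l => ?_⟩
  rw [hV, sum_mulVec, dotProduct_sum, Finset.sum_mul]
  refine Finset.sum_le_sum fun i _ => ?_
  have h0 : 0 ≤ l ⬝ᵥ (S *ᵥ l) := (posSemidef_real_iff.mp hS.posSemidef).2 l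
  have h1 := pow_le_pow_left₀ (abs_nonneg _) (abs_dotProduct_le_dual hS hC l (V i)) 2
  rw [sq_abs, mul_pow, Real.sq_sqrt h0] at h1
  rw [star_trivial, dotProduct_vecMulVec_mulVec, ← sq, dotProduct_comm (V i), mul_comm]
  exact h1

theorem nonneg_of_forall_small {x y : ℝ} (h : ∀ s : ℝ, 0 < s → s ≤ 1 → 0 ≤ x + s * y) :
    0 ≤ x := by
  have h1 : Filter.Tendsto (fun s : ℝ => x + s * y) (nhdsWithin 0 (Set.Ioi 0)) (nhds x) := by
    have : Filter.Tendsto (fun s : ℝ => x + s * y) (nhds 0) (nhds (x + 0 * y)) :=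
      Continuous.tendsto (by fun_prop) 0
    rw [zero_mul, add_zero] at this
    exact this.mono_left nhdsWithin_le_nhds
  refine ge_of_tendsto h1 ?_
  filter_upwards [Ioc_mem_nhdsGT (zero_lt_one (α := ℝ))] with s hs using h s hs.1 hs.2

/-! ### Conditional means and the probabilistic guarantee -/

theorem integrable_of_box {a b : Fin d → ℝ} {ν : Measure (Fin d → ℝ)} [IsFiniteMeasure ν]
    (h : ∀ᵐ u ∂ν, u ∈ Set.Icc a b) {g : (Fin d → ℝ) → ℝ} (hg : Continuous g) :
    Integrable g ν := by
  rw [← Measure.restrict_eq_self_of_ae_mem h]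
  exact hg.continuousOn.integrableOn_compact isCompact_Icc

theorem meanVec_dotProduct {a b : Fin d → ℝ} {ν : Measure (Fin d → ℝ)} [IsFiniteMeasure ν]
    (h : ∀ᵐ u ∂ν, u ∈ Set.Icc a b) (l : Fin d → ℝ) : meanVec ν ⬝ᵥ l = ∫ u, u ⬝ᵥ l ∂ν := by
  simp only [dotProduct, meanVec]
  rw [integral_finsetSum _ fun i _ => integrable_of_box h (by fun_prop)]
  simp [integral_mul_const]

theorem momentAbout_bilin {a b : Fin d → ℝ} {ν : Measure (Fin d → ℝ)} [IsFiniteMeasure ν]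
    (h : ∀ᵐ u ∂ν, u ∈ Set.Icc a b) (c k l : Fin d → ℝ) :
    k ⬝ᵥ (momentAbout ν c *ᵥ l) = ∫ u, ((u - c) ⬝ᵥ k) * ((u - c) ⬝ᵥ l) ∂ν := by
  have h1 : ∀ u : Fin d → ℝ, ((u - c) ⬝ᵥ k) * ((u - c) ⬝ᵥ l)
      = ∑ i, ∑ j, k i * ((u i - c i) * (u j - c j)) * l j := fun u => by
    rw [dotProduct, dotProduct, Finset.sum_mul_sum]
    refine Finset.sum_congr rfl fun i _ => Finset.sum_congr rfl fun j _ => ?_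
    simp only [Pi.sub_apply]; ring
  simp_rw [h1]
  rw [integral_finsetSum _ fun i _ => integrable_of_box h (by fun_prop)]
  simp only [dotProduct, mulVec, Finset.mul_sum, momentAbout, of_apply]
  refine Finset.sum_congr rfl fun i _ => ?_
  rw [integral_finsetSum _ fun i _ => integrable_of_box h (by fun_prop)]
  refine Finset.sum_congr rfl fun j _ => ?_
  rw [integral_mul_const, integral_const_mul, mul_assoc]

theorem momentAbout_quadForm {a b : Fin d → ℝ} {ν : Measure (Fin d → ℝ)} [IsFiniteMeasure ν]
    (h : ∀ᵐ u ∂ν, u ∈ Set.Icc a b) (c l : Fin d → ℝ) :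
    l ⬝ᵥ (momentAbout ν c *ᵥ l) = ∫ u, ((u - c) ⬝ᵥ l) ^ 2 ∂ν := by
  simp_rw [momentAbout_bilin h, sq]

theorem momentAbout_transpose (ν : Measure (Fin d → ℝ)) (c : Fin d → ℝ) :
    (momentAbout ν c)ᵀ = momentAbout ν c := by
  ext i j
  simp only [momentAbout, transpose_apply, of_apply]
  exact integral_congr_ae (.of_forall fun u => mul_comm _ _)

theorem momentAbout_eq {a b : Fin d → ℝ} {P : Measure (Fin d → ℝ)} [IsProbabilityMeasure P]
    (h : ∀ᵐ u ∂P, u ∈ Set.Icc a b) (c : Fin d → ℝ) :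
    momentAbout P c = momentAbout P 0 - vecMulVec (meanVec P) c - vecMulVec c (meanVec P)
      + vecMulVec c c := by
  ext i j
  have h1 : ∀ u : Fin d → ℝ, (u i - c i) * (u j - c j)
      = u i * u j - u i * c j - c i * u j + c i * c j := fun u => by ring
  simp only [momentAbout, meanVec, of_apply, vecMulVec_apply, Matrix.add_apply, Matrix.sub_apply, h1,
    Pi.zero_apply, sub_zero]
  rw [integral_add (integrable_of_box h (by fun_prop)) (integrable_const _),
    integral_sub (integrable_of_box h (by fun_prop)) (integrable_of_box h (by fun_prop)),
    integral_sub (integrable_of_box h (by fun_prop)) (integrable_of_box h (by fun_prop)),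
    integral_mul_const, integral_const_mul]
  simp

theorem momentAbout_eq_covMat_add {a b : Fin d → ℝ} {P : Measure (Fin d → ℝ)}
    [IsProbabilityMeasure P] (h : ∀ᵐ u ∂P, u ∈ Set.Icc a b) (c : Fin d → ℝ) :
    momentAbout P c = covMat P + vecMulVec (meanVec P - c) (meanVec P - c) := by
  rw [covMat, momentAbout_eq h, momentAbout_eq h (meanVec P), sub_vecMulVec, vecMulVec_sub,
    vecMulVec_sub]
  abel

/-- The matrix of moments of degree at most two of a measure is positive semidefinite. -/
theorem bordered_moments_posSemidef {a b : Fin d → ℝ} {ν : Measure (Fin d → ℝ)}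
    [IsFiniteMeasure ν] (h : ∀ᵐ u ∂ν, u ∈ Set.Icc a b) :
    (bordered (ν.real Set.univ) (meanVec ν) (momentAbout ν 0)).PosSemidef := by
  rw [bordered_posSemidef_iff]
  refine ⟨momentAbout_transpose _ _, fun c x => ?_⟩
  have h1 : c ^ 2 * ν.real Set.univ + 2 * c * (meanVec ν ⬝ᵥ x) + x ⬝ᵥ (momentAbout ν 0 *ᵥ x)
      = ∫ u, (c + u ⬝ᵥ x) ^ 2 ∂ν := by
    have : ∀ u : Fin d → ℝ, (c + u ⬝ᵥ x) ^ 2 = c ^ 2 + 2 * c * (u ⬝ᵥ x) + (u ⬝ᵥ x) ^ 2 :=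
      fun u => by ring
    simp_rw [this]
    rw [integral_add (integrable_of_box h (by fun_prop)) (integrable_of_box h (by fun_prop)),
      integral_add (integrable_of_box h (by fun_prop)) (integrable_of_box h (by fun_prop)),
      integral_const_mul, meanVec_dotProduct h, momentAbout_quadForm h]
    simp [mul_comm]
  rw [h1]
  exact integral_nonneg fun u => sq_nonneg _

theorem meanVec_box {a b : Fin d → ℝ} {ν : Measure (Fin d → ℝ)} [IsFiniteMeasure ν]
    (h : ∀ᵐ u ∂ν, u ∈ Set.Icc a b) :
    ν.real Set.univ • a ≤ meanVec ν ∧ meanVec ν ≤ ν.real Set.univ • b := by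
  refine ⟨fun i => ?_, fun i => ?_⟩
  · have := integral_mono_ae (integrable_const (a i)) (integrable_of_box h (continuous_apply i))
      (h.mono fun u hu => hu.1 i)
    simpa [meanVec] using this
  · have := integral_mono_ae (integrable_of_box h (continuous_apply i)) (integrable_const (b i))
      (h.mono fun u hu => hu.2 i)
    simpa [meanVec] using this

/-- The mean of `P` conditioned on an event of probability at least `ε` lies in `UDY`, for every
`P` in the confidence region. The remaining variables of the linear matrix inequalities are the
moments of the restrictions of `P` to the event and to its complement. -/
theorem condMean_mem_UDY {a b muHat : Fin d → ℝ} {SigHat C : Matrix (Fin d) (Fin d) ℝ}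
    {γ₁ γ₂ ε : ℝ} (hε : 0 < ε) (hC : Cᵀ * C = SigHat⁻¹)
    {P : Measure (Fin d → ℝ)} (hP : P ∈ PDY a b muHat SigHat γ₁ γ₂)
    {S : Set (Fin d → ℝ)} (hS : MeasurableSet S) (hSε : ε ≤ P.real S) :
    (P.real S)⁻¹ • meanVec (P.restrict S) ∈ UDY a b muHat SigHat C γ₁ γ₂ ε := by
  obtain ⟨hprob, hbox, hmean, hcov⟩ := hP
  set p := P.real S with hp
  have hp0 : 0 < p := hε.trans_le hSε
  have hbS : ∀ᵐ u ∂(P.restrict S), u ∈ Set.Icc a b := ae_restrict_of_ae hbox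
  have hbT : ∀ᵐ u ∂(P.restrict Sᶜ), u ∈ Set.Icc a b := ae_restrict_of_ae hbox
  have hpS : (P.restrict S).real Set.univ = p := by simp [hp]
  have hpT : (P.restrict Sᶜ).real Set.univ = 1 - p := by
    simp [hp, probReal_compl_eq_one_sub hS]
  have hsum : meanVec (P.restrict S) + meanVec (P.restrict Sᶜ) = meanVec P := by
    ext i
    exact integral_add_compl hS (integrable_of_box hbox (by fun_prop))
  have hsum2 : momentAbout (P.restrict S) 0 + momentAbout (P.restrict Sᶜ) 0
      = momentAbout P 0 := by
    ext i j
    exact integral_add_compl hS (integrable_of_box hbox (by fun_prop))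
  have hk : (0 : ℝ) ≤ p⁻¹ := (inv_pos.mpr hp0).le
  have hbdS := bordered_moments_posSemidef hbS
  have hbdT := bordered_moments_posSemidef hbT
  have hmS := meanVec_box hbS
  have hmT := meanVec_box hbT
  rw [hpS] at hbdS hmS
  rw [hpT] at hbdT hmT
  have hl1 : p⁻¹ - 1 = p⁻¹ * (1 - p) := by field_simp
  refine ⟨⟨?_, ?_⟩, p⁻¹, p⁻¹ • (muHat - meanVec P), p⁻¹ • meanVec (P.restrict Sᶜ),
    p⁻¹ • momentAbout (P.restrict Sᶜ) 0, p⁻¹ • momentAbout (P.restrict S) 0,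
    (bordered_lower hbdT).smul hk, (bordered_lower hbdS).smul hk, ?_, ?_, ?_, ?_, ?_, ?_, ?_, ?_⟩
  · have := smul_le_smul_of_nonneg_left hmS.1 hk
    rwa [smul_smul, inv_mul_cancel₀ hp0.ne', one_smul] at this
  · have := smul_le_smul_of_nonneg_left hmS.2 hk
    rwa [smul_smul, inv_mul_cancel₀ hp0.ne', one_smul] at this
  · rw [one_div]; exact inv_anti₀ hε hSε
  · rw [hl1, mul_smul]; exact smul_le_smul_of_nonneg_left hmT.1 hk
  · rw [hl1, mul_smul]; exact smul_le_smul_of_nonneg_left hmT.2 hk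
  · rw [hl1, bordered_smul]; exact hbdT.smul hk
  · have := hbdS.smul hk
    rwa [← bordered_smul, inv_mul_cancel₀ hp0.ne'] at this
  · rw [← smul_add, add_comm (meanVec (P.restrict Sᶜ)), hsum, ← smul_add]
    congr 1; abel
  · rw [mulVec_smul, euclNorm, WithLp.toLp_smul, norm_smul, Real.norm_of_nonneg hk]
    refine mul_le_mul_of_nonneg_left (Real.le_sqrt_of_sq_le ?_) hk
    change euclNorm _ ^ 2 ≤ _
    rw [euclNorm_mulVec_sq hC, ← neg_sub, mulVec_neg, neg_dotProduct, dotProduct_neg, neg_neg]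
    exact hmean
  · have key : p⁻¹ • (γ₂ • SigHat + vecMulVec muHat muHat) - p⁻¹ • momentAbout (P.restrict Sᶜ) 0
        - p⁻¹ • momentAbout (P.restrict S) 0
        - vecMulVec (p⁻¹ • (muHat - meanVec P)) muHat
        - vecMulVec muHat (p⁻¹ • (muHat - meanVec P))
        = p⁻¹ • (γ₂ • SigHat - momentAbout P muHat) := by
      rw [momentAbout_eq hbox, ← hsum2, smul_vecMulVec, vecMulVec_smul, sub_vecMulVec,
        vecMulVec_sub]
      module
    rw [key]
    exact hcov.smul hk

/-- Jensen's inequality for a conditional mean: a concave function is positive at the mean of `P`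
conditioned on the function being positive. -/
theorem pos_condMean {a b : Fin d → ℝ} {P : Measure (Fin d → ℝ)} [IsProbabilityMeasure P]
    (hbox : ∀ᵐ u ∂P, u ∈ Set.Icc a b) {f : (Fin d → ℝ) → ℝ} (hf : ConcaveOn ℝ Set.univ f)
    (hpos : 0 < P.real {u | 0 < f u}) :
    0 < f ((P.real {u | 0 < f u})⁻¹ • meanVec (P.restrict {u | 0 < f u})) := by
  have hcont : Continuous f := continuousOn_univ.mp (hf.continuousOn isOpen_univ)
  set S := {u | 0 < f u}
  have hS : MeasurableSet S := measurableSet_lt measurable_const hcont.measurable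
  have hbS : ∀ᵐ u ∂(P.restrict S), u ∈ Set.Icc a b := ae_restrict_of_ae hbox
  have hint : Integrable (fun u : Fin d → ℝ => u) (P.restrict S) :=
    Integrable.of_eval fun i => integrable_of_box hbS (by fun_prop)
  have hne : P S ≠ 0 := fun h => by simp [measureReal_def, h] at hpos
  have hJ := hf.le_map_set_average (f := fun u : Fin d → ℝ => u) (μ := P) (t := S)
    hcont.continuousOn isClosed_univ hne (measure_ne_top _ _) (by simp) hint
    (integrable_of_box hbS hcont)
  rw [setAverage_eq, setAverage_eq] at hJ
  have hmean : ∫ x in S, x ∂P = meanVec (P.restrict S) := by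
    ext i
    exact eval_integral (fun i => hint.eval i) i
  rw [hmean] at hJ
  refine lt_of_lt_of_le ?_ hJ
  refine mul_pos (inv_pos.mpr hpos) ?_
  rw [setIntegral_pos_iff_support_of_nonneg_ae
    (ae_restrict_of_forall_mem hS fun u hu => le_of_lt hu) (integrable_of_box hbS hcont)]
  have : Function.support f ∩ S = S := Set.inter_eq_right.mpr fun u hu => ne_of_gt hu
  rw [this]
  exact pos_iff_ne_zero.mpr hne

/-- Every distribution in the confidence region enjoys the guarantee that `UDY` implies: if `f` were
positive with probability more than `ε`, it would be positive at the corresponding conditional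
mean, a point of `UDY`. -/
theorem simultaneouslyImpliesGuarantee {a b muHat : Fin d → ℝ}
    {SigHat C : Matrix (Fin d) (Fin d) ℝ} {γ₁ γ₂ : ℝ} (hC : Cᵀ * C = SigHat⁻¹)
    {P : Measure (Fin d → ℝ)} (hP : P ∈ PDY a b muHat SigHat γ₁ γ₂) :
    SimultaneouslyImpliesGuarantee (fun ε => UDY a b muHat SigHat C γ₁ γ₂ ε) P := by
  intro ε hε _ k f hf xs hU
  have := hP.1
  have hcont : Continuous fun u => f u xs :=
    continuousOn_univ.mp ((hf xs).continuousOn isOpen_univ)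
  have hS : MeasurableSet {u | 0 < f u xs} := measurableSet_lt measurable_const hcont.measurable
  have hcompl : {u | f u xs ≤ 0} = {u | 0 < f u xs}ᶜ := by ext; simp
  rw [hcompl, probReal_compl_eq_one_sub hS]
  by_contra! hlt
  have hlt' : ε < P.real {u | 0 < f u xs} := by linarith
  exact absurd (hU _ (condMean_mem_UDY hε hC hP hS hlt'.le))
    (not_le.mpr (pos_condMean hP.2.1 (hf xs) (hε.trans hlt')))

theorem bddBelow_VaR {a b : Fin d → ℝ} {P : Measure (Fin d → ℝ)}
    (hbox : ∀ᵐ u ∂P, u ∈ Set.Icc a b) {ε : ℝ} (hε : ε < 1) (v : Fin d → ℝ) :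
    BddBelow {t : ℝ | 1 - ε ≤ P.real {u | u ⬝ᵥ v ≤ t}} := by
  obtain ⟨K, hK⟩ := (isCompact_Icc (a := a) (b := b)).bddBelow_image
    (f := fun u => u ⬝ᵥ v) (by fun_prop)
  refine ⟨K, fun t ht => ?_⟩
  by_contra! hlt
  have h0 : P {u | u ⬝ᵥ v ≤ t} = 0 := by
    refine measure_mono_null (fun u hu => ?_) hbox
    exact fun hu' => absurd (hK ⟨u, hu', rfl⟩) (not_le.mpr (lt_of_le_of_lt hu hlt))
  have ht' : 1 - ε ≤ P.real {u | u ⬝ᵥ v ≤ t} := ht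
  rw [measureReal_def, h0, ENNReal.toReal_zero] at ht'
  linarith

theorem VaR_le_of_UDY_le {a b muHat : Fin d → ℝ} {SigHat C : Matrix (Fin d) (Fin d) ℝ}
    {γ₁ γ₂ ε : ℝ} (hε : 0 < ε) (hε1 : ε < 1) (hC : Cᵀ * C = SigHat⁻¹)
    {P : Measure (Fin d → ℝ)} (hP : P ∈ PDY a b muHat SigHat γ₁ γ₂) {v : Fin d → ℝ} {c : ℝ}
    (hc : ∀ u ∈ UDY a b muHat SigHat C γ₁ γ₂ ε, v ⬝ᵥ u ≤ c) : VaR ε P v ≤ c := by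
  refine csInf_le (bddBelow_VaR hP.2.1 hε1 v) ?_
  have hconc : ∀ x : Fin 0 → ℝ, ConcaveOn ℝ Set.univ fun u : Fin d → ℝ => u ⬝ᵥ v - c :=
    fun _ => by
      refine ⟨convex_univ, fun x _ y _ s t _ _ hst => ?_⟩
      simp only [add_dotProduct, smul_dotProduct, smul_eq_mul]
      have : c = s * c + t * c := by rw [← add_mul, hst, one_mul]
      linarith
  have := simultaneouslyImpliesGuarantee hC hP ε hε hε1 0 (fun u _ => u ⬝ᵥ v - c) hconc 0
    fun u hu => by
      have := hc u hu
      rw [dotProduct_comm] at this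
      exact sub_nonpos.mpr this
  simp only [sub_nonpos] at this
  exact this

/-! ### Value at Risk and two-point distributions -/

theorem nonempty_VaR {a b : Fin d → ℝ} {P : Measure (Fin d → ℝ)} [IsProbabilityMeasure P]
    (hbox : ∀ᵐ u ∂P, u ∈ Set.Icc a b) {ε : ℝ} (hε : 0 < ε) (v : Fin d → ℝ) :
    {t : ℝ | 1 - ε ≤ P.real {u | u ⬝ᵥ v ≤ t}}.Nonempty := by
  obtain ⟨K, hK⟩ := (isCompact_Icc (a := a) (b := b)).bddAbove_image
    (f := fun u => u ⬝ᵥ v) (by fun_prop)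
  refine ⟨K, ?_⟩
  have h1 : P {u | u ⬝ᵥ v ≤ K} = 1 :=
    (mem_ae_iff_prob_eq_one (measurableSet_le (by fun_prop) measurable_const)).mp
      (hbox.mono fun u hu => hK ⟨u, hu, rfl⟩)
  change 1 - ε ≤ P.real _
  rw [measureReal_def, h1, ENNReal.toReal_one]
  linarith

/-- The Value at Risk is at least the value at any atom of mass more than `ε`. -/
theorem le_VaR {a b : Fin d → ℝ} {P : Measure (Fin d → ℝ)} [IsProbabilityMeasure P]
    (hbox : ∀ᵐ u ∂P, u ∈ Set.Icc a b) {ε : ℝ} (hε : 0 < ε) (v u : Fin d → ℝ)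
    (hu : ε < P.real {u}) : v ⬝ᵥ u ≤ VaR ε P v := by
  refine le_csInf (nonempty_VaR hbox hε v) fun t ht => ?_
  by_contra! hlt
  have hmeas : MeasurableSet {u : Fin d → ℝ | u ⬝ᵥ v ≤ t} :=
    measurableSet_le (by fun_prop) measurable_const
  have hsub : ({u} : Set (Fin d → ℝ)) ⊆ {u | u ⬝ᵥ v ≤ t}ᶜ := by
    rw [Set.singleton_subset_iff]
    rw [dotProduct_comm] at hlt
    exact not_le.mpr hlt
  have h1 := measureReal_mono (μ := P) hsub
  rw [probReal_compl_eq_one_sub hmeas] at h1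
  have ht' : 1 - ε ≤ P.real {u | u ⬝ᵥ v ≤ t} := ht
  linarith

/-- The distribution with mass `p` at `u` and mass `1 - p` at `x`. -/
noncomputable def twoPoint (p : ℝ) (u x : Fin d → ℝ) : Measure (Fin d → ℝ) :=
  ENNReal.ofReal p • Measure.dirac u + ENNReal.ofReal (1 - p) • Measure.dirac x

theorem isProbabilityMeasure_twoPoint {p : ℝ} (h0 : 0 ≤ p) (h1 : p ≤ 1) (u x : Fin d → ℝ) :
    IsProbabilityMeasure (twoPoint p u x) := by
  constructor
  simp only [twoPoint, Measure.coe_add, Measure.coe_smul, Pi.add_apply, Pi.smul_apply,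
    measure_univ, smul_eq_mul, mul_one]
  rw [← ENNReal.ofReal_add h0 (sub_nonneg.mpr h1)]
  simp

theorem integral_twoPoint {p : ℝ} (h0 : 0 ≤ p) (h1 : p ≤ 1) (u x : Fin d → ℝ)
    (g : (Fin d → ℝ) → ℝ) : ∫ y, g y ∂(twoPoint p u x) = p * g u + (1 - p) * g x := by
  rw [twoPoint, integral_add_measure
      ((integrable_dirac (by simp)).smul_measure ENNReal.ofReal_ne_top)
      ((integrable_dirac (by simp)).smul_measure ENNReal.ofReal_ne_top),
    integral_smul_measure, integral_smul_measure, integral_dirac, integral_dirac,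
    ENNReal.toReal_ofReal h0, ENNReal.toReal_ofReal (sub_nonneg.mpr h1)]
  rfl

theorem le_twoPoint_singleton {p : ℝ} (h1 : p ≤ 1) (u x : Fin d → ℝ) :
    p ≤ (twoPoint p u x).real {u} := by
  by_cases h0 : 0 ≤ p
  · have := isProbabilityMeasure_twoPoint h0 h1 u x
    rw [measureReal_def, ← ENNReal.ofReal_le_iff_le_toReal (measure_ne_top _ _)]
    simp [twoPoint]
  · exact (not_le.mp h0).le.trans measureReal_nonneg

/-- A point of `UDY` whose variable `lam` satisfies `lam < 1 / ε` carries mass `lam⁻¹ > ε` in a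
two-point distribution of the confidence region, whose Value at Risk is therefore at least the
value at the point. -/
theorem exists_PDY_le_VaR {a b muHat : Fin d → ℝ} {SigHat C : Matrix (Fin d) (Fin d) ℝ}
    {γ₁ γ₂ ε : ℝ} (hγ₁ : 0 ≤ γ₁) (hε : 0 < ε) (hS : SigHatᵀ = SigHat)
    (hC : Cᵀ * C = SigHat⁻¹) {u w m : Fin d → ℝ} {lam : ℝ} {A Ahat : Matrix (Fin d) (Fin d) ℝ}
    (hu : u ∈ Set.Icc a b) (hlam : lam < 1 / ε) (hma : (lam - 1) • a ≤ m)
    (hmb : m ≤ (lam - 1) • b) (hA : (bordered (lam - 1) m A).PosSemidef)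
    (hAhat : (bordered 1 u Ahat).PosSemidef) (hw : lam • muHat = m + u + w)
    (hCw : euclNorm (C *ᵥ w) ≤ lam * √γ₁)
    (hM : (lam • (γ₂ • SigHat + vecMulVec muHat muHat) - A - Ahat
        - vecMulVec w muHat - vecMulVec muHat w).PosSemidef) (v : Fin d → ℝ) :
    ∃ P ∈ PDY a b muHat SigHat γ₁ γ₂, v ⬝ᵥ u ≤ VaR ε P v := by
  have hl1 : 0 ≤ lam - 1 := bordered_corner hA
  have hl0 : 0 < lam := by linarith
  -- for `lam = 1` the box constraints force `m = 0`, and the second atom has no mass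
  obtain ⟨x, hmx, hx⟩ : ∃ x : Fin d → ℝ, m = (lam - 1) • x ∧ x ∈ Set.Icc a b := by
    rcases hl1.eq_or_lt with h | h
    · rw [← h, zero_smul] at hma hmb
      exact ⟨u, by rw [← h, zero_smul]; exact le_antisymm hmb hma, hu⟩
    · have hi := (inv_pos.mpr h).le
      refine ⟨(lam - 1)⁻¹ • m, by rw [smul_smul, mul_inv_cancel₀ h.ne', one_smul], ?_, ?_⟩
      · have := smul_le_smul_of_nonneg_left hma hi
        rwa [smul_smul, inv_mul_cancel₀ h.ne', one_smul] at this
      · have := smul_le_smul_of_nonneg_left hmb hi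
        rwa [smul_smul, inv_mul_cancel₀ h.ne', one_smul] at this
  have hp0 : 0 ≤ lam⁻¹ := (inv_pos.mpr hl0).le
  have hp1 : lam⁻¹ ≤ 1 := inv_le_one_of_one_le₀ (by linarith)
  have hprob := isProbabilityMeasure_twoPoint hp0 hp1 u x
  have hbox : ∀ᵐ y ∂(twoPoint lam⁻¹ u x), y ∈ Set.Icc a b := by
    rw [twoPoint, ae_add_measure_iff]
    constructor
    · exact Measure.ae_smul_measure (by rw [ae_dirac_eq]; exact hu) _
    · exact Measure.ae_smul_measure (by rw [ae_dirac_eq]; exact hx) _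
  have hmean : meanVec (twoPoint lam⁻¹ u x) - muHat = -(lam⁻¹ • w) := by
    have hw' : w = lam • muHat - m - u := by rw [hw]; abel
    ext i
    simp only [meanVec, Pi.sub_apply, Pi.neg_apply, Pi.smul_apply, smul_eq_mul, hw', hmx,
      integral_twoPoint hp0 hp1 u x (fun y => y i)]
    field_simp
    ring
  refine ⟨twoPoint lam⁻¹ u x, ⟨hprob, hbox, ?_, ?_⟩, le_VaR hbox hε v u
    (lt_of_lt_of_le ?_ (le_twoPoint_singleton hp1 u x))⟩
  · rw [hmean, mulVec_neg, neg_dotProduct, dotProduct_neg, neg_neg, ← euclNorm_mulVec_sq hC,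
      mulVec_smul, euclNorm, WithLp.toLp_smul, norm_smul, Real.norm_of_nonneg hp0]
    have h1 : lam⁻¹ * euclNorm (C *ᵥ w) ≤ √γ₁ := by
      rw [inv_mul_le_iff₀ hl0]; exact hCw
    calc (lam⁻¹ * euclNorm (C *ᵥ w)) ^ 2 ≤ √γ₁ ^ 2 :=
          pow_le_pow_left₀ (mul_nonneg hp0 (euclNorm_nonneg _)) h1 2
      _ = γ₁ := Real.sq_sqrt hγ₁
  · rw [posSemidef_real_iff]
    refine ⟨by rw [transpose_sub, transpose_smul, hS, momentAbout_transpose], fun l => ?_⟩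
    have h1 := (posSemidef_real_iff.mp hM).2 l
    have h2 := bordered_schur (k := 1) (x := u) (by rwa [one_smul]) l (A := Ahat)
    rw [hmx] at hA
    have h3 := bordered_schur hA l
    have h4 : lam * (muHat ⬝ᵥ l) = (lam - 1) * (x ⬝ᵥ l) + u ⬝ᵥ l + w ⬝ᵥ l := by
      have := congrArg (· ⬝ᵥ l) hw
      simpa [hmx, add_dotProduct] using this
    simp only [sub_mulVec, add_mulVec, smul_mulVec, dotProduct_sub, dotProduct_add,
      dotProduct_smul, smul_eq_mul, dotProduct_vecMulVec_mulVec] at h1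
    rw [sub_mulVec, dotProduct_sub, momentAbout_quadForm hbox, integral_twoPoint hp0 hp1,
      smul_mulVec, dotProduct_smul, smul_eq_mul, sub_dotProduct, sub_dotProduct]
    generalize l ⬝ᵥ (SigHat *ᵥ l) = s at *
    generalize l ⬝ᵥ (A *ᵥ l) = sA at *
    generalize l ⬝ᵥ (Ahat *ᵥ l) = sAh at *
    generalize muHat ⬝ᵥ l = M at *
    generalize x ⬝ᵥ l = X at *
    generalize u ⬝ᵥ l = U at *
    have h5 : w ⬝ᵥ l = lam * M - (lam - 1) * X - U := by linarith
    rw [h5] at h1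
    have h6 : 0 ≤ lam * (γ₂ * s) - (U - M) ^ 2 - (lam - 1) * (X - M) ^ 2 := by nlinarith
    have h7 : γ₂ * s - (lam⁻¹ * (U - M) ^ 2 + (1 - lam⁻¹) * (X - M) ^ 2)
        = lam⁻¹ * (lam * (γ₂ * s) - (U - M) ^ 2 - (lam - 1) * (X - M) ^ 2) := by
      field_simp
      ring
    rw [h7]
    exact mul_nonneg hp0 h6
  · rw [lt_inv_comm₀ hε hl0, ← one_div]; exact hlam

/-! ### The lifted variables and the worst-case Value at Risk -/

/-- The space of the variables `(lam, u, m, A, Ahat)` of the linear matrix inequalities. The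
variable `w` is left out, since the other ones determine it. -/
abbrev Lift (d : ℕ) : Type :=
  ℝ × (Fin d → ℝ) × (Fin d → ℝ) × Matrix (Fin d) (Fin d) ℝ × Matrix (Fin d) (Fin d) ℝ

/-- The variables that satisfy the constraints of `UDY` in which neither the sample nor the
thresholds occur. -/
def liftSet (a b : Fin d → ℝ) (ε : ℝ) : Set (Lift d) :=
  {x | x.2.1 ∈ Set.Icc a b ∧ x.1 ≤ 1 / ε ∧ (x.1 - 1) • a ≤ x.2.2.1 ∧ x.2.2.1 ≤ (x.1 - 1) • b ∧
    (bordered (x.1 - 1) x.2.2.1 x.2.2.2.1).PosSemidef ∧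
    (bordered 1 x.2.1 x.2.2.2.2).PosSemidef}

/-- The variable `w` as a function of the other ones. -/
def shift (muHat : Fin d → ℝ) (x : Lift d) : Fin d → ℝ := x.1 • muHat - x.2.2.1 - x.2.1

/-- The left hand side of the last linear matrix inequality of `UDY`. -/
def covSlack (muHat : Fin d → ℝ) (SigHat : Matrix (Fin d) (Fin d) ℝ) (γ₂ : ℝ) (x : Lift d) :
    Matrix (Fin d) (Fin d) ℝ :=
  x.1 • (γ₂ • SigHat + vecMulVec muHat muHat) - x.2.2.2.1 - x.2.2.2.2
    - vecMulVec (shift muHat x) muHat - vecMulVec muHat (shift muHat x)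

theorem mem_UDY_iff {a b muHat : Fin d → ℝ} {SigHat C : Matrix (Fin d) (Fin d) ℝ}
    {γ₁ γ₂ ε : ℝ} {u : Fin d → ℝ} :
    u ∈ UDY a b muHat SigHat C γ₁ γ₂ ε ↔ ∃ x ∈ liftSet a b ε, x.2.1 = u ∧
      euclNorm (C *ᵥ shift muHat x) ≤ x.1 * √γ₁ ∧ (covSlack muHat SigHat γ₂ x).PosSemidef := by
  constructor
  · rintro ⟨hu, lam, w, m, A, Ahat, -, -, hlam, hma, hmb, hA, hAhat, hw, hCw, hM⟩
    have hw' : shift muHat (lam, u, m, A, Ahat) = w := by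
      simp only [shift, hw]; abel
    refine ⟨(lam, u, m, A, Ahat), ⟨hu, hlam, hma, hmb, hA, hAhat⟩, rfl, ?_, ?_⟩
    · rwa [hw']
    · rwa [covSlack, hw']
  · rintro ⟨⟨lam, u, m, A, Ahat⟩, ⟨hu, hlam, hma, hmb, hA, hAhat⟩, rfl, hCw, hM⟩
    refine ⟨hu, lam, _, m, A, Ahat, bordered_lower hA, bordered_lower hAhat, hlam, hma, hmb, hA,
      hAhat, ?_, hCw, hM⟩
    simp only [shift]; abel

theorem convex_liftSet (a b : Fin d → ℝ) (ε : ℝ) : Convex ℝ (liftSet a b ε) := by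
  rintro ⟨lam, u, m, A, Ahat⟩ ⟨h1, h2, h3, h4, h5, h6⟩ ⟨lam', u', m', A', Ahat'⟩
    ⟨h1', h2', h3', h4', h5', h6'⟩ s t hs ht hst
  have hl : s * lam + t * lam' - 1 = s * (lam - 1) + t * (lam' - 1) := by linear_combination hst
  dsimp only at *
  refine ⟨convex_Icc a b h1 h1' hs ht hst, ?_, ?_, ?_, ?_, ?_⟩
  · exact convex_Iic (1 / ε) (Set.mem_Iic.mpr h2) (Set.mem_Iic.mpr h2') hs ht hst
  · change (s * lam + t * lam' - 1) • a ≤ s • m + t • m'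
    rw [hl, add_smul, mul_smul, mul_smul]
    exact add_le_add (smul_le_smul_of_nonneg_left h3 hs) (smul_le_smul_of_nonneg_left h3' ht)
  · change s • m + t • m' ≤ (s * lam + t * lam' - 1) • b
    rw [hl, add_smul, mul_smul, mul_smul]
    exact add_le_add (smul_le_smul_of_nonneg_left h4 hs) (smul_le_smul_of_nonneg_left h4' ht)
  · change (bordered (s * lam + t * lam' - 1) (s • m + t • m') (s • A + t • A')).PosSemidef
    rw [hl, bordered_comb]
    exact posSemidef_comb h5 h5' hs ht
  · change (bordered 1 (s • u + t • u') (s • Ahat + t • Ahat')).PosSemidef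
    have := posSemidef_comb h6 h6' hs ht
    rwa [← bordered_comb, mul_one, mul_one, hst] at this

theorem shift_comb (muHat : Fin d → ℝ) (s t : ℝ) (x y : Lift d) :
    shift muHat (s • x + t • y) = s • shift muHat x + t • shift muHat y := by
  simp only [shift, Prod.fst_add, Prod.snd_add, Prod.smul_fst, Prod.smul_snd, smul_eq_mul]
  module

theorem covSlack_comb (muHat : Fin d → ℝ) (SigHat : Matrix (Fin d) (Fin d) ℝ) (γ₂ s t : ℝ)
    (x y : Lift d) : covSlack muHat SigHat γ₂ (s • x + t • y)
      = s • covSlack muHat SigHat γ₂ x + t • covSlack muHat SigHat γ₂ y := by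
  simp only [covSlack, shift_comb, Prod.fst_add, Prod.snd_add, Prod.smul_fst, Prod.smul_snd,
    smul_eq_mul, add_vecMulVec, vecMulVec_add, smul_vecMulVec, vecMulVec_smul]
  module

/-- The variables that correspond to the Dirac mass at the sample mean. -/
def diracLift (muHat : Fin d → ℝ) : Lift d := (1, muHat, 0, 0, vecMulVec muHat muHat)

theorem diracLift_mem {a b muHat : Fin d → ℝ} (h : muHat ∈ Set.Icc a b) {ε : ℝ} (hε : 0 < ε)
    (hε1 : ε ≤ 1) : diracLift muHat ∈ liftSet a b ε := by
  refine ⟨h, (one_le_div₀ hε).mpr hε1, by simp [diracLift], by simp [diracLift], ?_, ?_⟩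
  · have := bordered_smul_self_posSemidef le_rfl muHat
    simpa [diracLift] using this
  · have := bordered_smul_self_posSemidef zero_le_one muHat
    simpa [diracLift] using this

theorem shift_diracLift (muHat : Fin d → ℝ) : shift muHat (diracLift muHat) = 0 := by
  simp [shift, diracLift]

theorem covSlack_diracLift (muHat : Fin d → ℝ) (SigHat : Matrix (Fin d) (Fin d) ℝ) (γ₂ : ℝ) :
    covSlack muHat SigHat γ₂ (diracLift muHat) = γ₂ • SigHat := by
  simp [covSlack, shift_diracLift]
  simp [diracLift]

theorem muHat_mem_UDY {a b muHat : Fin d → ℝ} {SigHat C : Matrix (Fin d) (Fin d) ℝ}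
    {γ₁ γ₂ ε : ℝ} (h : muHat ∈ Set.Icc a b) (hS : SigHat.PosSemidef) (hγ₂ : 0 ≤ γ₂)
    (hε : 0 < ε) (hε1 : ε ≤ 1) : muHat ∈ UDY a b muHat SigHat C γ₁ γ₂ ε := by
  rw [mem_UDY_iff]
  refine ⟨_, diracLift_mem h hε hε1, rfl, ?_, ?_⟩
  · rw [shift_diracLift, mulVec_zero]
    simp [euclNorm, diracLift]
  · rw [covSlack_diracLift]
    exact hS.smul hγ₂

/-- An upper bound for the Value at Risk over the confidence region bounds the linear functional
on `UDY`: mixing with the Dirac mass at the sample mean makes `lam` smaller than `1 / ε`. -/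
theorem le_of_VaR_le {a b muHat : Fin d → ℝ} {SigHat C : Matrix (Fin d) (Fin d) ℝ}
    {γ₁ γ₂ ε : ℝ} (h : muHat ∈ Set.Icc a b) (hS : SigHat.PosSemidef) (hγ₁ : 0 ≤ γ₁)
    (hγ₂ : 0 ≤ γ₂) (hε : 0 < ε) (hε1 : ε < 1) (hC : Cᵀ * C = SigHat⁻¹) {v : Fin d → ℝ} {K : ℝ}
    (hK : ∀ P ∈ PDY a b muHat SigHat γ₁ γ₂, VaR ε P v ≤ K) {u : Fin d → ℝ}
    (hu : u ∈ UDY a b muHat SigHat C γ₁ γ₂ ε) : v ⬝ᵥ u ≤ K := by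
  obtain ⟨x, hx, rfl, hCw, hM⟩ := mem_UDY_iff.mp hu
  suffices h1 : ∀ s : ℝ, 0 < s → s ≤ 1 → 0 ≤ (K - v ⬝ᵥ x.2.1) + s * (v ⬝ᵥ x.2.1 - v ⬝ᵥ muHat) from
    sub_nonneg.mp (nonneg_of_forall_small h1)
  intro s hs hs1
  have ht : 0 ≤ 1 - s := sub_nonneg.mpr hs1
  obtain ⟨h1, h2, h3, h4, h5, h6⟩ :=
    convex_liftSet a b ε hx (diracLift_mem h hε hε1.le) ht hs.le (sub_add_cancel 1 s)
  set y := (1 - s) • x + s • diracLift muHat with hy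
  have hy1 : y.1 = (1 - s) * x.1 + s := by simp [hy, diracLift]
  have hε1' : 1 < 1 / ε := (one_lt_div₀ hε).mpr hε1
  have hshift : shift muHat y = (1 - s) • shift muHat x := by
    rw [hy, shift_comb, shift_diracLift, smul_zero, add_zero]
  obtain ⟨P, hP, hle⟩ := exists_PDY_le_VaR (C := C) (γ₁ := γ₁) (γ₂ := γ₂) (muHat := muHat)
    (SigHat := SigHat) (ε := ε) (lam := y.1) (w := shift muHat y) hγ₁ hε
    (posSemidef_real_iff.mp hS).1 hC h1
    (by rw [hy1]; nlinarith [mul_le_mul_of_nonneg_left hx.2.1 ht]) h3 h4 h5 h6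
    (by simp only [shift]; abel)
    (by
      rw [hshift, mulVec_smul, euclNorm, WithLp.toLp_smul, norm_smul, Real.norm_of_nonneg ht, hy1]
      have := mul_le_mul_of_nonneg_left hCw ht
      rw [euclNorm] at this
      nlinarith [Real.sqrt_nonneg γ₁])
    (by
      have := posSemidef_comb hM (covSlack_diracLift muHat SigHat γ₂ ▸ hS.smul hγ₂) ht hs.le
      rw [← covSlack_comb] at this
      exact this) v
  have h7 := hle.trans (hK P hP)
  have h8 : v ⬝ᵥ y.2.1 = (1 - s) * (v ⬝ᵥ x.2.1) + s * (v ⬝ᵥ muHat) := by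
    simp [hy, diracLift, dotProduct_add, dotProduct_smul]
  linarith

theorem isLUB_VaR {a b muHat : Fin d → ℝ} {SigHat C : Matrix (Fin d) (Fin d) ℝ}
    {γ₁ γ₂ ε : ℝ} (h : muHat ∈ Set.Icc a b) (hS : SigHat.PosSemidef) (hγ₁ : 0 ≤ γ₁)
    (hγ₂ : 0 ≤ γ₂) (hε : 0 < ε) (hε1 : ε < 1) (hC : Cᵀ * C = SigHat⁻¹) {v : Fin d → ℝ} {c : ℝ}
    (hc : IsLUB ((fun u => v ⬝ᵥ u) '' UDY a b muHat SigHat C γ₁ γ₂ ε) c) :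
    IsLUB ((fun P => VaR ε P v) '' PDY a b muHat SigHat γ₁ γ₂) c := by
  refine ⟨?_, fun K hK => hc.2 ?_⟩
  · rintro _ ⟨P, hP, rfl⟩
    exact VaR_le_of_UDY_le hε hε1 hC hP fun u hu => hc.1 ⟨u, hu, rfl⟩
  · rintro _ ⟨u, hu, rfl⟩
    exact le_of_VaR_le h hS hγ₁ hγ₂ hε hε1 hC (fun P hP => hK ⟨P, hP, rfl⟩) hu

/-! ### Duality for the semidefinite program -/

theorem trace_mul_covSlack {Z : Matrix (Fin d) (Fin d) ℝ} (hZ : Zᵀ = Z) (muHat : Fin d → ℝ)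
    (SigHat : Matrix (Fin d) (Fin d) ℝ) (γ₂ : ℝ) (x : Lift d) :
    (Z * covSlack muHat SigHat γ₂ x).trace
      = x.1 * (Z * (γ₂ • SigHat + vecMulVec muHat muHat)).trace - (Z * x.2.2.2.1).trace
        - (Z * x.2.2.2.2).trace - 2 * (shift muHat x ⬝ᵥ (Z *ᵥ muHat)) := by
  simp only [covSlack, Matrix.mul_sub, trace_sub, Matrix.mul_smul, trace_smul, smul_eq_mul,
    trace_mul_vecMulVec]
  rw [dotProduct_mulVec_comm hZ muHat]
  ring

theorem trace_transpose_mul_eq {S Z : Matrix (Fin d) (Fin d) ℝ} (hS : Sᵀ = S) (γ : ℝ)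
    (c : Fin d → ℝ) : ((γ • S + vecMulVec c c)ᵀ * Z).trace
      = (Z * (γ • S + vecMulVec c c)).trace := by
  rw [transpose_add, transpose_smul, hS, transpose_vecMulVec, trace_mul_comm]

/-- Weak duality. -/
theorem le_of_mem_sdpValues {a b muHat : Fin d → ℝ} {SigHat C : Matrix (Fin d) (Fin d) ℝ}
    {γ₁ γ₂ ε : ℝ} (hS : SigHat.PosDef) (hε : 0 < ε) (hC : Cᵀ * C = SigHat⁻¹)
    {u v : Fin d → ℝ} (hu : u ∈ UDY a b muHat SigHat C γ₁ γ₂ ε) {t : ℝ}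
    (ht : t ∈ sdpValues a b muHat SigHat γ₁ γ₂ ε v) : v ⬝ᵥ u ≤ t := by
  obtain ⟨x, ⟨hub, hlam, hma, hmb, hA, hAhat⟩, rfl, hCw, hM⟩ := mem_UDY_iff.mp hu
  obtain ⟨r, s, θ, q, y₁, y₁p, y₁m, y₂, y₂p, y₂m, Z, hrs, hB1, hB2, hs, rfl, rfl, h1p, h1m, h2p,
    h2m, hθ⟩ := ht
  have hZ : Z.PosSemidef := bordered_lower hB1
  have hZt := (posSemidef_real_iff.mp hZ).1
  have hl1 : 0 ≤ x.1 - 1 := bordered_corner hA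
  have T1 := trace_mul_nonneg hB1 hA
  have T2 := trace_mul_nonneg hB2 hAhat
  have T3 := trace_mul_nonneg hZ hM
  rw [trace_bordered_mul] at T1 T2
  rw [trace_mul_covSlack hZt] at T3
  rw [trace_transpose_mul_eq (posDef_real_iff.mp hS).1] at hs
  have hCS := (neg_le_abs _).trans (abs_dotProduct_le_dual hS hC (q + (2 : ℝ) • (Z *ᵥ muHat)) (shift muHat x))
  set D := √((q + (2 : ℝ) • (Z *ᵥ muHat)) ⬝ᵥ (SigHat *ᵥ (q + (2 : ℝ) • (Z *ᵥ muHat))))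
  have hD : 0 ≤ D := Real.sqrt_nonneg _
  have hCS' := hCS.trans (mul_le_mul_of_nonneg_left hCw hD)
  have e1 := dotProduct_le_dotProduct_of_nonneg_left hma h1p
  have e2 := dotProduct_le_dotProduct_of_nonneg_left hmb h1m
  have e3 := dotProduct_le_dotProduct_of_nonneg_left hub.1 h2p
  have e4 := dotProduct_le_dotProduct_of_nonneg_left hub.2 h2m
  have e5 : q ⬝ᵥ shift muHat x = x.1 * (muHat ⬝ᵥ q) - q ⬝ᵥ x.2.2.1 - q ⬝ᵥ x.2.1 := by
    simp [shift, dotProduct_sub, dotProduct_smul, dotProduct_comm q muHat]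
  have e6 : x.1 * ε ≤ 1 := by rwa [le_div_iff₀ hε] at hlam
  simp only [add_dotProduct, smul_dotProduct, sub_dotProduct, dotProduct_smul, smul_eq_mul,
    dotProduct_comm (Z *ᵥ muHat)] at T1 T2 T3 hCS' e1 e2
  have e7 := mul_le_mul_of_nonneg_left hs (by linarith : 0 ≤ x.1)
  have e8 := mul_le_mul_of_nonneg_left hrs (by linarith : 0 ≤ x.1)
  have e9 := mul_le_mul_of_nonneg_left e6 hθ
  linarith

/-- First order optimality for a convex quadratic function on a box: at a minimizer, the positive
and negative parts of the gradient are multipliers of the box constraints, and they turn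
nonnegativity on the box into a linear matrix inequality. -/
theorem exists_box_multipliers {a b : Fin d → ℝ} (hab : a ≤ b) {Z : Matrix (Fin d) (Fin d) ℝ}
    (hZ : Z.PosSemidef) (q : Fin d → ℝ) :
    ∃ x ∈ Set.Icc a b, (∀ y ∈ Set.Icc a b, q ⬝ᵥ x + x ⬝ᵥ (Z *ᵥ x) ≤ q ⬝ᵥ y + y ⬝ᵥ (Z *ᵥ y)) ∧
      ∃ yp ym : Fin d → ℝ, 0 ≤ yp ∧ 0 ≤ ym ∧
        (bordered (-(q ⬝ᵥ x + x ⬝ᵥ (Z *ᵥ x)) + yp ⬝ᵥ a - ym ⬝ᵥ b)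
          ((1 / 2 : ℝ) • (q - (yp - ym))) Z).PosSemidef := by
  obtain ⟨hZt, hZ0⟩ := posSemidef_real_iff.mp hZ
  obtain ⟨x, hx, hmin⟩ := (isCompact_Icc (a := a) (b := b)).exists_isMinOn
    (Set.nonempty_Icc.mpr hab) (f := fun y => q ⬝ᵥ y + y ⬝ᵥ (Z *ᵥ y)) (by fun_prop)
  have hmin' : ∀ y ∈ Set.Icc a b, q ⬝ᵥ x + x ⬝ᵥ (Z *ᵥ x) ≤ q ⬝ᵥ y + y ⬝ᵥ (Z *ᵥ y) :=
    fun y hy => hmin hy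
  set g := q + (2 : ℝ) • (Z *ᵥ x) with hg
  -- the variational inequality
  have hvar : ∀ y ∈ Set.Icc a b, g ⬝ᵥ x ≤ g ⬝ᵥ y := fun y hy => by
    suffices h : ∀ s : ℝ, 0 < s → s ≤ 1 → 0 ≤ g ⬝ᵥ (y - x) + s * ((y - x) ⬝ᵥ (Z *ᵥ (y - x))) by
      have := nonneg_of_forall_small h
      rw [dotProduct_sub] at this
      linarith
    intro s hs hs1
    have h1 := hmin' (x + s • (y - x)) ((convex_Icc a b).add_smul_sub_mem hx hy ⟨hs.le, hs1⟩)
    generalize y - x = h at *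
    simp only [hg, dotProduct_add, add_dotProduct, mulVec_add, mulVec_smul, smul_dotProduct,
      dotProduct_smul, smul_eq_mul, dotProduct_mulVec_comm hZt h x,
      dotProduct_comm (Z *ᵥ x)] at h1 ⊢
    refine nonneg_of_mul_nonneg_right (a := s) ?_ hs
    linarith
  -- the box minimizes the linear form `g` at a vertex
  have hvert : g ⬝ᵥ x ≤ g⁺ ⬝ᵥ a - g⁻ ⬝ᵥ b := by
    refine (hvar (fun i => if 0 ≤ g i then a i else b i) ⟨fun i => ?_, fun i => ?_⟩).trans_eq ?_
    · dsimp only; split_ifs; exacts [le_rfl, hab i]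
    · dsimp only; split_ifs; exacts [hab i, le_rfl]
    · simp only [dotProduct, ← Finset.sum_sub_distrib]
      refine Finset.sum_congr rfl fun i _ => ?_
      rw [Pi.posPart_apply, Pi.negPart_apply]
      split_ifs with h
      · rw [posPart_of_nonneg h, negPart_of_nonneg h]; ring
      · rw [posPart_of_nonpos (not_le.mp h).le, negPart_of_nonpos (not_le.mp h).le]; ring
  refine ⟨x, hx, hmin', g⁺, g⁻, posPart_nonneg g, negPart_nonneg g, ?_⟩
  rw [bordered_posSemidef_iff]
  refine ⟨hZt, fun c y => ?_⟩
  have h1 : (1 / 2 : ℝ) • (q - (g⁺ - g⁻)) = -(Z *ᵥ x) := by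
    rw [posPart_sub_negPart, hg]; module
  have h2 := hZ0 (y - c • x)
  have h3 : g ⬝ᵥ x = q ⬝ᵥ x + 2 * (x ⬝ᵥ (Z *ᵥ x)) := by
    rw [hg, add_dotProduct, smul_dotProduct, smul_eq_mul, dotProduct_comm (Z *ᵥ x)]
  rw [h1]
  simp only [mulVec_sub, mulVec_smul, sub_dotProduct, dotProduct_sub, smul_dotProduct,
    dotProduct_smul, smul_eq_mul, dotProduct_mulVec_comm hZt x y] at h2
  rw [neg_dotProduct, dotProduct_comm (Z *ᵥ x)]
  nlinarith [mul_le_mul_of_nonneg_left hvert (sq_nonneg c)]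

/-- A minimax theorem in the form of an alternative: if at every point of a compact convex set
some `y` makes the value larger than `t`, then a single `y` does so at all points. -/
theorem exists_forall_lt_of_forall_exists_lt {E F : Type*}
    [TopologicalSpace E] [AddCommGroup E] [Module ℝ E] [IsTopologicalAddGroup E]
    [ContinuousSMul ℝ E] [TopologicalSpace F] [AddCommGroup F] [Module ℝ F]
    [IsTopologicalAddGroup F] [ContinuousSMul ℝ F] {X : Set E} {Y : Set F} {f : E → F → ℝ}
    (hX : X.Nonempty) (kX : IsCompact X) (cX : Convex ℝ X) (cY : Convex ℝ Y)
    (hfy : ∀ y ∈ Y, Continuous fun x => f x y) (hfy' : ∀ y ∈ Y, ConvexOn ℝ X fun x => f x y)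
    (hfx : ∀ x ∈ X, Continuous fun y => f x y) (hfx' : ∀ x ∈ X, ConcaveOn ℝ Y fun y => f x y)
    {t : ℝ} (h : ∀ x ∈ X, ∃ y ∈ Y, t < f x y) : ∃ y ∈ Y, ∀ x ∈ X, t < f x y := by
  obtain ⟨T, hTY, hTfin, hT⟩ := kX.elim_finite_subcover_image
    (b := Y) (c := fun y => {x | t < f x y})
    (fun y hy => isOpen_lt continuous_const (hfy y hy))
    (fun x hx => by
      obtain ⟨y, hy, hlt⟩ := h x hx
      exact Set.mem_biUnion hy hlt)
  refine Sion.exists_lt_iInf_of_lt_iInf_of_finite hX kX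
    (fun y hy => (hfy y hy).lowerSemicontinuous.lowerSemicontinuousOn _)
    (fun y hy => (hfy' y hy).quasiconvexOn) cY
    (fun x hx => (hfx x hx).upperSemicontinuous.upperSemicontinuousOn _)
    (fun x hx => (hfx' x hx).quasiconcaveOn) cX hTfin hTY fun x hx => ?_
  obtain ⟨y, hy, hlt⟩ := Set.mem_iUnion₂.mp (hT hx)
  exact ⟨y, hy, hlt⟩

theorem isClosed_setOf_posSemidef {n X : Type*} [Fintype n] [TopologicalSpace X]
    {M : X → Matrix n n ℝ} (hM : Continuous M) : IsClosed {x | (M x).PosSemidef} := by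
  simp only [posSemidef_real_iff, Set.ofPred_and, Set.ofPred_forall]
  exact (isClosed_eq (by fun_prop) hM).inter
    (isClosed_iInter fun z => isClosed_le continuous_const (by fun_prop))

theorem continuous_bordered {X : Type*} [TopologicalSpace X] {r : X → ℝ} {m : X → Fin d → ℝ}
    {A : X → Matrix (Fin d) (Fin d) ℝ} (hr : Continuous r) (hm : Continuous m)
    (hA : Continuous A) : Continuous fun x => bordered (r x) (m x) (A x) := by
  refine continuous_matrix fun i j => ?_
  rcases i with i | i <;> rcases j with j | j
  · exact hr
  · exact (continuous_apply j).comp hm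
  · exact (continuous_apply i).comp hm
  · exact hA.matrix_elem i j

theorem continuous_shift (muHat : Fin d → ℝ) : Continuous (shift muHat) := by
  unfold shift; fun_prop

theorem continuous_covSlack (muHat : Fin d → ℝ) (SigHat : Matrix (Fin d) (Fin d) ℝ) (γ₂ : ℝ) :
    Continuous (covSlack muHat SigHat γ₂) := by
  have := continuous_shift muHat
  unfold covSlack; fun_prop

theorem isClosed_liftSet (a b : Fin d → ℝ) (ε : ℝ) : IsClosed (liftSet a b ε) := by
  refine (isClosed_Icc.preimage (by fun_prop : Continuous fun x : Lift d => x.2.1)).inter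
    ((isClosed_le (f := fun x : Lift d => x.1) (g := fun _ => 1 / ε)
      (by fun_prop) (by fun_prop)).inter
    ((isClosed_le (f := fun x : Lift d => (x.1 - 1) • a) (g := fun x => x.2.2.1)
      (by fun_prop) (by fun_prop)).inter
    ((isClosed_le (f := fun x : Lift d => x.2.2.1) (g := fun x => (x.1 - 1) • b)
      (by fun_prop) (by fun_prop)).inter (IsClosed.inter ?_ ?_))))
  · exact isClosed_setOf_posSemidef (continuous_bordered (by fun_prop) (by fun_prop) (by fun_prop))
  · exact isClosed_setOf_posSemidef (continuous_bordered (by fun_prop) (by fun_prop) (by fun_prop))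

/-- The variables whose vector and matrices `m, A, Ahat` are bounded by `B` in all entries. -/
def entryBound (d : ℕ) (B : ℝ) : Set (Lift d) :=
  {x | x.2.2.1 ∈ Set.univ.pi (fun _ => Set.Icc (-B) B) ∧
    x.2.2.2.1 ∈ Set.univ.pi (fun _ => Set.univ.pi fun _ => Set.Icc (-B) B) ∧
    x.2.2.2.2 ∈ Set.univ.pi (fun _ => Set.univ.pi fun _ => Set.Icc (-B) B)}

theorem convex_entryBound (B : ℝ) : Convex ℝ (entryBound d B) := by
  have h1 : Convex ℝ (Set.univ.pi (fun _ : Fin d => Set.Icc (-B) B)) :=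
    convex_pi fun _ _ => convex_Icc _ _
  have h2 : Convex ℝ (Set.univ.pi (fun _ : Fin d => Set.univ.pi fun _ : Fin d =>
    Set.Icc (-B) B)) := convex_pi fun _ _ => h1
  intro x hx y hy s t hs ht hst
  exact ⟨h1 hx.1 hy.1 hs ht hst, h2 hx.2.1 hy.2.1 hs ht hst, h2 hx.2.2 hy.2.2 hs ht hst⟩

theorem isCompact_liftSet_inter (a b : Fin d → ℝ) (ε B : ℝ) :
    IsCompact (liftSet a b ε ∩ entryBound d B) := by
  have h1 : IsCompact (Set.univ.pi (fun _ : Fin d => Set.Icc (-B) B)) :=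
    isCompact_univ_pi fun _ => isCompact_Icc
  have h2 : IsCompact (X := Matrix (Fin d) (Fin d) ℝ)
      (Set.univ.pi (fun _ : Fin d => Set.univ.pi fun _ : Fin d => Set.Icc (-B) B)) :=
    isCompact_univ_pi fun _ => h1
  have hK : IsCompact ((Set.Icc (1 : ℝ) (1 / ε)) ×ˢ (Set.Icc a b) ×ˢ
      (Set.univ.pi (fun _ : Fin d => Set.Icc (-B) B)) ×ˢ
      (Set.univ.pi (fun _ : Fin d => Set.univ.pi fun _ : Fin d => Set.Icc (-B) B) :
        Set (Matrix (Fin d) (Fin d) ℝ)) ×ˢ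
      (Set.univ.pi (fun _ : Fin d => Set.univ.pi fun _ : Fin d => Set.Icc (-B) B) :
        Set (Matrix (Fin d) (Fin d) ℝ))) :=
    isCompact_Icc.prod (isCompact_Icc.prod (h1.prod (h2.prod h2)))
  have hE : entryBound d B = {x : Lift d | x.2.2 ∈
      (Set.univ.pi (fun _ : Fin d => Set.Icc (-B) B)) ×ˢ
      (Set.univ.pi (fun _ : Fin d => Set.univ.pi fun _ : Fin d => Set.Icc (-B) B) :
        Set (Matrix (Fin d) (Fin d) ℝ)) ×ˢ
      (Set.univ.pi (fun _ : Fin d => Set.univ.pi fun _ : Fin d => Set.Icc (-B) B) :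
        Set (Matrix (Fin d) (Fin d) ℝ))} := rfl
  refine hK.of_isClosed_subset ((isClosed_liftSet a b ε).inter ?_) fun x hx => ?_
  · rw [hE]
    exact (h1.prod (h2.prod h2)).isClosed.preimage (by fun_prop)
  · have := bordered_corner hx.1.2.2.2.2.1
    exact ⟨⟨by linarith, hx.1.2.1⟩, hx.1.1, hx.2⟩

/-- The variables that correspond to the two-point distribution with mass `1 / lam` at `u` and the
remaining mass at `x`. -/
def twoPointLift (lam : ℝ) (u x : Fin d → ℝ) : Lift d :=
  (lam, u, (lam - 1) • x, (lam - 1) • vecMulVec x x, vecMulVec u u)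

theorem twoPointLift_mem {a b : Fin d → ℝ} {ε lam : ℝ} {u x : Fin d → ℝ} (hu : u ∈ Set.Icc a b)
    (hx : x ∈ Set.Icc a b) (h1 : 1 ≤ lam) (h2 : lam ≤ 1 / ε) :
    twoPointLift lam u x ∈ liftSet a b ε := by
  have h0 : 0 ≤ lam - 1 := sub_nonneg.mpr h1
  refine ⟨hu, h2, smul_le_smul_of_nonneg_left hx.1 h0, smul_le_smul_of_nonneg_left hx.2 h0,
    bordered_smul_self_posSemidef h0 x, ?_⟩
  have := bordered_smul_self_posSemidef zero_le_one u
  rwa [one_smul, one_smul] at this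

/-- The entries of the variables of the two-point distributions on the box have a common bound. -/
theorem exists_entryBound (a b : Fin d → ℝ) {ε : ℝ} (hε : 0 < ε) :
    ∃ B, ∀ lam u x, 1 ≤ lam → lam ≤ 1 / ε → u ∈ Set.Icc a b → x ∈ Set.Icc a b →
      twoPointLift lam u x ∈ entryBound d B := by
  obtain ⟨K, hK1, hK⟩ : ∃ K : ℝ, 1 ≤ K ∧ ∀ u ∈ Set.Icc a b, ∀ i, |u i| ≤ K := by
    refine ⟨1 + ∑ i, (|a i| + |b i|), le_add_of_nonneg_right
      (Finset.sum_nonneg fun i _ => by positivity), fun u hu i => ?_⟩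
    have h1 : |a i| + |b i| ≤ ∑ i, (|a i| + |b i|) :=
      Finset.single_le_sum (f := fun i => |a i| + |b i|) (fun i _ => by positivity)
        (Finset.mem_univ i)
    have h2 : |u i| ≤ |a i| + |b i| := abs_le.mpr
      ⟨by have := hu.1 i; have := neg_abs_le (a i); have := abs_nonneg (b i); linarith,
        by have := hu.2 i; have := le_abs_self (b i); have := abs_nonneg (a i); linarith⟩
    linarith
  have hε' : 0 < 1 / ε := one_div_pos.mpr hε
  refine ⟨(1 + 1 / ε) * K ^ 2, fun lam u x h1 h2 hu hx => ?_⟩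
  have hl : |lam - 1| ≤ 1 / ε := abs_le.mpr ⟨by linarith, by linarith⟩
  have hxx : ∀ {u} (_ : u ∈ Set.Icc a b) i j, |u i * u j| ≤ K ^ 2 := fun hu i j => by
    rw [abs_mul, sq]
    exact mul_le_mul (hK _ hu i) (hK _ hu j) (abs_nonneg _) (by linarith)
  refine ⟨fun i _ => abs_le.mp ?_, fun i _ j _ => abs_le.mp ?_, fun i _ j _ => abs_le.mp ?_⟩
  · change |(lam - 1) * x i| ≤ _
    rw [abs_mul]
    have : |lam - 1| * |x i| ≤ 1 / ε * K := mul_le_mul hl (hK _ hx i) (abs_nonneg _) hε'.le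
    have h3 : 1 / ε * K ≤ 1 / ε * K ^ 2 :=
      mul_le_mul_of_nonneg_left (by nlinarith) hε'.le
    nlinarith
  · change |(lam - 1) * (x i * x j)| ≤ _
    rw [abs_mul]
    have : |lam - 1| * |x i * x j| ≤ 1 / ε * K ^ 2 :=
      mul_le_mul hl (hxx hx i j) (abs_nonneg _) hε'.le
    nlinarith
  · change |u i * u j| ≤ _
    have := hxx hu i j
    nlinarith [mul_nonneg hε'.le (sq_nonneg K)]

/-- The Lagrangian of the maximization of `v ⬝ᵥ u` over `UDY`: the multiplier `Z` belongs to the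
matrix inequality, and `ξ` to the norm constraint `‖C w‖ ≤ lam √γ₁`. -/
noncomputable def lagrangian (muHat : Fin d → ℝ) (SigHat C : Matrix (Fin d) (Fin d) ℝ)
    (γ₁ γ₂ : ℝ) (v : Fin d → ℝ) (x : Lift d)
    (y : Matrix (Fin d) (Fin d) ℝ × EuclideanSpace ℝ (Fin d)) : ℝ :=
  v ⬝ᵥ x.2.1 + (y.1 * covSlack muHat SigHat γ₂ x).trace
    + (x.1 * √γ₁ * ‖y.2‖ - y.2.ofLp ⬝ᵥ (C *ᵥ shift muHat x))

theorem convexOn_neg_lagrangian (muHat : Fin d → ℝ) (SigHat C : Matrix (Fin d) (Fin d) ℝ)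
    (γ₁ γ₂ : ℝ) (v : Fin d → ℝ) (y : Matrix (Fin d) (Fin d) ℝ × EuclideanSpace ℝ (Fin d))
    {X : Set (Lift d)} (hX : Convex ℝ X) :
    ConvexOn ℝ X fun x => -lagrangian muHat SigHat C γ₁ γ₂ v x y := by
  refine ⟨hX, fun x _ x' _ s t _ _ _ => le_of_eq ?_⟩
  simp only [lagrangian, covSlack_comb, shift_comb, Matrix.mul_add, Matrix.mul_smul, trace_add,
    trace_smul, mulVec_add, mulVec_smul, dotProduct_add, dotProduct_smul, Prod.fst_add,
    Prod.snd_add, Prod.smul_fst, Prod.smul_snd, smul_eq_mul]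
  ring

theorem concaveOn_neg_lagrangian (muHat : Fin d → ℝ) (SigHat C : Matrix (Fin d) (Fin d) ℝ)
    (γ₁ γ₂ : ℝ) (v : Fin d → ℝ) {x : Lift d} (hx : 0 ≤ x.1)
    {Y : Set (Matrix (Fin d) (Fin d) ℝ × EuclideanSpace ℝ (Fin d))} (hY : Convex ℝ Y) :
    ConcaveOn ℝ Y fun y => -lagrangian muHat SigHat C γ₁ γ₂ v x y := by
  refine ConvexOn.neg ⟨hY, fun y _ y' _ s t hs ht hst => ?_⟩
  have h1 : ‖s • y.2 + t • y'.2‖ ≤ s * ‖y.2‖ + t * ‖y'.2‖ := by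
    refine (norm_add_le _ _).trans_eq ?_
    rw [norm_smul, norm_smul, Real.norm_of_nonneg hs, Real.norm_of_nonneg ht]
  have h2 := mul_le_mul_of_nonneg_left h1 (mul_nonneg hx (Real.sqrt_nonneg γ₁))
  have h3 : v ⬝ᵥ x.2.1 = s * (v ⬝ᵥ x.2.1) + t * (v ⬝ᵥ x.2.1) := by rw [← add_mul, hst, one_mul]
  simp only [lagrangian, Matrix.add_mul, Matrix.smul_mul, trace_add, trace_smul, add_dotProduct,
    smul_dotProduct, Prod.fst_add, Prod.snd_add, Prod.smul_fst, Prod.smul_snd, smul_eq_mul,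
    WithLp.ofLp_add, WithLp.ofLp_smul]
  linarith

/-- If `v ⬝ᵥ u < c` on `UDY`, then at every point some multipliers push the Lagrangian
below `c`. -/
theorem exists_lagrangian_lt {a b muHat : Fin d → ℝ} {SigHat C : Matrix (Fin d) (Fin d) ℝ}
    {γ₁ γ₂ ε : ℝ} (hS : SigHatᵀ = SigHat) {v : Fin d → ℝ} {c : ℝ}
    (hc : ∀ u ∈ UDY a b muHat SigHat C γ₁ γ₂ ε, v ⬝ᵥ u < c) {x : Lift d}
    (hx : x ∈ liftSet a b ε) :
    ∃ y : Matrix (Fin d) (Fin d) ℝ × EuclideanSpace ℝ (Fin d), y.1.PosSemidef ∧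
      lagrangian muHat SigHat C γ₁ γ₂ v x y < c := by
  have hunb : ∀ {e : ℝ}, e < 0 → ∃ k : ℝ, 0 ≤ k ∧ v ⬝ᵥ x.2.1 + k * e < c := fun {e} he => by
    refine ⟨(|v ⬝ᵥ x.2.1 - c| + 1) / (-e), div_nonneg (by positivity) (by linarith), ?_⟩
    have h1 : (|v ⬝ᵥ x.2.1 - c| + 1) / (-e) * e = -(|v ⬝ᵥ x.2.1 - c| + 1) := by
      field_simp [he.ne]
    rw [h1]
    have := le_abs_self (v ⬝ᵥ x.2.1 - c)
    linarith
  by_cases hM : (covSlack muHat SigHat γ₂ x).PosSemidef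
  · by_cases hw : euclNorm (C *ᵥ shift muHat x) ≤ x.1 * √γ₁
    · refine ⟨0, PosSemidef.zero, ?_⟩
      simpa [lagrangian] using hc _ (mem_UDY_iff.mpr ⟨x, hx, rfl, hw, hM⟩)
    · have hl : 0 ≤ x.1 := by have := bordered_corner hx.2.2.2.2.1; linarith
      have hn : 0 < euclNorm (C *ᵥ shift muHat x) :=
        (mul_nonneg hl (Real.sqrt_nonneg _)).trans_lt (not_le.mp hw)
      obtain ⟨k, hk, hlt⟩ := hunb
        (mul_neg_of_pos_of_neg hn (sub_neg_of_lt (not_le.mp hw)))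
      refine ⟨(0, k • WithLp.toLp 2 (C *ᵥ shift muHat x)), PosSemidef.zero, ?_⟩
      have h1 : ‖WithLp.toLp 2 (C *ᵥ shift muHat x)‖ = euclNorm (C *ᵥ shift muHat x) := rfl
      have h2 := euclNorm_sq (C *ᵥ shift muHat x)
      simp only [lagrangian, norm_smul, Real.norm_of_nonneg hk, h1, WithLp.ofLp_smul,
        smul_dotProduct, ← h2, Matrix.zero_mul, trace_zero, smul_eq_mul]
      linarith
  · have hMt : (covSlack muHat SigHat γ₂ x)ᵀ = covSlack muHat SigHat γ₂ x := by
      have hA := (bordered_posSemidef_iff.mp hx.2.2.2.2.1).1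
      have hAh := (bordered_posSemidef_iff.mp hx.2.2.2.2.2).1
      simp only [covSlack, transpose_sub, transpose_smul, transpose_add, transpose_vecMulVec, hS,
        hA, hAh]
      abel
    rw [posSemidef_real_iff] at hM
    push Not at hM
    obtain ⟨l, hl⟩ := hM hMt
    obtain ⟨k, hk, hlt⟩ := hunb hl
    have hll : (vecMulVec l l).PosSemidef := posSemidef_vecMulVec_self_star l
    refine ⟨(k • vecMulVec l l, 0), hll.smul hk, ?_⟩
    simp only [lagrangian, Matrix.smul_mul, trace_smul, norm_zero, WithLp.ofLp_zero,
      zero_dotProduct, smul_eq_mul]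
    rw [trace_mul_comm, trace_mul_vecMulVec]
    linarith

/-- Strong duality: every number above the linear functional on `UDY` is a feasible value of the
semidefinite program. The multipliers of the Lagrangian give `Z` and `q`, and those of the two
quadratic problems on the box that remain give the other variables. -/
theorem mem_sdpValues_of_lt {a b muHat : Fin d → ℝ} {SigHat C : Matrix (Fin d) (Fin d) ℝ}
    {γ₁ γ₂ ε : ℝ} (h : muHat ∈ Set.Icc a b) (hS : SigHat.PosDef)
    (hγ₂ : 0 ≤ γ₂) (hε : 0 < ε) (hε1 : ε < 1) (hC : Cᵀ * C = SigHat⁻¹)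
    {v : Fin d → ℝ} {c : ℝ} (hc : ∀ u ∈ UDY a b muHat SigHat C γ₁ γ₂ ε, v ⬝ᵥ u < c) :
    c ∈ sdpValues a b muHat SigHat γ₁ γ₂ ε v := by
  have hSt := (posDef_real_iff.mp hS).1
  have hε1' : 1 ≤ 1 / ε := (one_le_div₀ hε).mpr hε1.le
  obtain ⟨B, hB⟩ := exists_entryBound a b hε
  obtain ⟨⟨Z, ξ⟩, hZ, hL⟩ := exists_forall_lt_of_forall_exists_lt
    (X := liftSet a b ε ∩ entryBound d B)
    (Y := {y : Matrix (Fin d) (Fin d) ℝ × EuclideanSpace ℝ (Fin d) | y.1.PosSemidef})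
    (f := fun x y => -lagrangian muHat SigHat C γ₁ γ₂ v x y) (t := -c)
    ⟨_, twoPointLift_mem h h le_rfl hε1', hB _ _ _ le_rfl hε1' h h⟩
    (isCompact_liftSet_inter a b ε B) ((convex_liftSet a b ε).inter (convex_entryBound B))
    (fun y hy y' hy' s t hs ht _ => posSemidef_comb hy hy' hs ht)
    (fun y _ => by
      have := continuous_shift muHat
      have := continuous_covSlack muHat SigHat γ₂
      unfold lagrangian; fun_prop)
    (fun y _ => convexOn_neg_lagrangian muHat SigHat C γ₁ γ₂ v y
      ((convex_liftSet a b ε).inter (convex_entryBound B)))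
    (fun x _ => by unfold lagrangian; fun_prop)
    (fun x hx => by
      have := bordered_corner hx.1.2.2.2.2.1
      exact concaveOn_neg_lagrangian muHat SigHat C γ₁ γ₂ v (by linarith)
        fun y hy y' hy' s t hs ht _ => posSemidef_comb hy hy' hs ht)
    (fun x hx => by
      obtain ⟨y, hy, hlt⟩ := exists_lagrangian_lt hSt hc hx.1
      exact ⟨y, hy, neg_lt_neg hlt⟩)
  replace hZ : Z.PosSemidef := hZ
  have hZt := (posSemidef_real_iff.mp hZ).1
  set q : Fin d → ℝ := -((2 : ℝ) • (Z *ᵥ muHat) + Cᵀ *ᵥ ξ.ofLp) with hq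
  obtain ⟨x₁, hx₁, hmin, y₁p, y₁m, h1p, h1m, hB1⟩ := exists_box_multipliers (h.1.trans h.2) hZ q
  obtain ⟨x₂, hx₂, -, y₂p, y₂m, h2p, h2m, hB2⟩ :=
    exists_box_multipliers (h.1.trans h.2) hZ (q - v)
  -- the dual norm of `q + 2 Z μ̂` is the norm of the multiplier `ξ`
  have hnorm : √((q + (2 : ℝ) • (Z *ᵥ muHat)) ⬝ᵥ (SigHat *ᵥ (q + (2 : ℝ) • (Z *ᵥ muHat))))
      = ‖ξ‖ := by
    have h1 : q + (2 : ℝ) • (Z *ᵥ muHat) = -(Cᵀ *ᵥ ξ.ofLp) := by rw [hq]; abel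
    rw [h1, mulVec_neg, neg_dotProduct, dotProduct_neg, neg_neg, ← vecMul_transpose,
      transpose_transpose, ← dotProduct_mulVec, mulVec_mulVec, ← mulVec_transpose, mulVec_mulVec,
      mul_mul_transpose_eq_one hS.isUnit hC, one_mulVec, ← euclNorm_sq,
      Real.sqrt_sq (euclNorm_nonneg _)]
    rfl
  set s := (Z * (γ₂ • SigHat + vecMulVec muHat muHat)).trace + muHat ⬝ᵥ q + √γ₁ * ‖ξ‖ with hs
  -- the Lagrangian at a two-point distribution
  have hval : ∀ lam u x, lagrangian muHat SigHat C γ₁ γ₂ v (twoPointLift lam u x) (Z, ξ)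
      = lam * s - ((q - v) ⬝ᵥ u + u ⬝ᵥ (Z *ᵥ u)) - (lam - 1) * (q ⬝ᵥ x + x ⬝ᵥ (Z *ᵥ x)) :=
    fun lam u x => by
    have h1 : ξ.ofLp ⬝ᵥ (C *ᵥ shift muHat (twoPointLift lam u x))
        = -(q ⬝ᵥ shift muHat (twoPointLift lam u x))
          - 2 * (shift muHat (twoPointLift lam u x) ⬝ᵥ (Z *ᵥ muHat)) := by
      rw [hq, dotProduct_mulVec, ← mulVec_transpose, neg_dotProduct, add_dotProduct,
        smul_dotProduct, smul_eq_mul, dotProduct_comm (Z *ᵥ muHat)]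
      ring
    have h2 : q ⬝ᵥ shift muHat (twoPointLift lam u x)
        = lam * (muHat ⬝ᵥ q) - (lam - 1) * (q ⬝ᵥ x) - q ⬝ᵥ u := by
      simp [shift, twoPointLift, dotProduct_sub, dotProduct_smul, dotProduct_comm q muHat]
    rw [lagrangian, trace_mul_covSlack hZt, h1, h2, hs]
    simp only [twoPointLift, Matrix.mul_smul, trace_smul, trace_mul_vecMulVec, smul_eq_mul,
      sub_dotProduct]
    ring
  -- the two extreme values of `lam` suffice to bound the Lagrangian
  have hL1 := hL _ ⟨twoPointLift_mem hx₂ hx₁ le_rfl hε1', hB _ _ _ le_rfl hε1' hx₂ hx₁⟩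
  have hL2 := hL _ ⟨twoPointLift_mem hx₂ hx₁ hε1' le_rfl, hB _ _ _ hε1' le_rfl hx₂ hx₁⟩
  simp only [hval] at hL1 hL2
  -- the objective of the first box problem at the sample mean
  have hr : 0 ≤ -(q ⬝ᵥ x₁ + x₁ ⬝ᵥ (Z *ᵥ x₁)) + s := by
    have h1 := hmin muHat h
    have h2 := mul_nonneg hγ₂ (trace_mul_nonneg hZ hS.posSemidef)
    have h3 : 0 ≤ √γ₁ * ‖ξ‖ := by positivity
    rw [hs, Matrix.mul_add, trace_add, Matrix.mul_smul, trace_smul, smul_eq_mul,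
      trace_mul_vecMulVec, dotProduct_comm muHat q]
    linarith
  set r := -(q ⬝ᵥ x₁ + x₁ ⬝ᵥ (Z *ᵥ x₁)) with hr'
  set ρ := -((q - v) ⬝ᵥ x₂ + x₂ ⬝ᵥ (Z *ᵥ x₂)) with hρ
  refine ⟨r, s, r + c - ρ, q, y₁p - y₁m, y₁p, y₁m, y₂p - y₂m, y₂p, y₂m, Z, ?_, hB1, ?_, ?_, rfl,
    rfl, h1p, h1m, h2p, h2m, by linarith⟩
  · have e1 : 1 / ε * s + ρ + (1 / ε - 1) * r < c := by linarith
    have e2 := mul_lt_mul_of_pos_right e1 hε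
    have e3 : (1 / ε * s + ρ + (1 / ε - 1) * r) * ε = s + ρ * ε + (1 - ε) * r := by
      field_simp
    rw [e3] at e2
    nlinarith
  · have e1 : r + y₂p ⬝ᵥ a - y₂m ⬝ᵥ b + c - (r + c - ρ) = ρ + y₂p ⬝ᵥ a - y₂m ⬝ᵥ b := by ring
    have e2 : q - (y₂p - y₂m) - v = q - v - (y₂p - y₂m) := by abel
    rw [e1, e2]
    exact hB2
  · rw [trace_transpose_mul_eq hSt, hnorm]

/-- The linear functional on `UDY`, the worst-case Value at Risk and the semidefinite program have
the same finite optimal value. -/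
theorem exists_common_value {a b muHat : Fin d → ℝ} {SigHat C : Matrix (Fin d) (Fin d) ℝ}
    {γ₁ γ₂ ε : ℝ} (h : muHat ∈ Set.Icc a b) (hS : SigHat.PosDef) (hγ₁ : 0 ≤ γ₁)
    (hγ₂ : 0 ≤ γ₂) (hε : 0 < ε) (hε1 : ε < 1) (hC : Cᵀ * C = SigHat⁻¹) (v : Fin d → ℝ) :
    ∃ c : ℝ, IsLUB ((fun u => v ⬝ᵥ u) '' UDY a b muHat SigHat C γ₁ γ₂ ε) c ∧
      IsLUB ((fun P => VaR ε P v) '' PDY a b muHat SigHat γ₁ γ₂) c ∧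
      IsGLB (sdpValues a b muHat SigHat γ₁ γ₂ ε v) c := by
  have hne : ((fun u => v ⬝ᵥ u) '' UDY a b muHat SigHat C γ₁ γ₂ ε).Nonempty :=
    ⟨_, muHat, muHat_mem_UDY h hS.posSemidef hγ₂ hε hε1.le, rfl⟩
  have hbdd : BddAbove ((fun u => v ⬝ᵥ u) '' UDY a b muHat SigHat C γ₁ γ₂ ε) :=
    ((isCompact_Icc (a := a) (b := b)).bddAbove_image (f := fun u => v ⬝ᵥ u) (by fun_prop)).mono
      (Set.image_mono fun u hu => hu.1)
  have hlub := isLUB_csSup hne hbdd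
  refine ⟨_, hlub, isLUB_VaR h hS.posSemidef hγ₁ hγ₂ hε hε1 hC hlub, fun t ht => hlub.2 ?_,
    fun K hK => le_of_forall_gt_imp_ge_of_dense fun c hc => ?_⟩
  · rintro _ ⟨u, hu, rfl⟩
    exact le_of_mem_sdpValues hS hε hC hu ht
  · exact hK (mem_sdpValues_of_lt h hS hγ₂ hε hε1 hC fun u hu =>
      (hlub.1 ⟨u, hu, rfl⟩).trans_lt hc)

/-! ### McDiarmid's inequality and means of bounded random vectors -/

section BoundedDifferences

variable {α : Type*} [MeasurableSpace α] {μ : Measure α} [IsProbabilityMeasure μ]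

theorem integrable_of_abs_le {β : Type*} [MeasurableSpace β] {ν : Measure β} [IsFiniteMeasure ν]
    {f : β → ℝ} (hf : Measurable f) {M : ℝ} (hM : ∀ x, |f x| ≤ M) : Integrable f ν :=
  Integrable.of_bound hf.aestronglyMeasurable M (.of_forall hM)

/-- Hoeffding's lemma for a random variable with oscillation at most `c`. -/
theorem integral_exp_le_of_oscillation {g : α → ℝ} (hg : Measurable g) {c : ℝ} (hc : 0 ≤ c)
    (h : ∀ x y, |g x - g y| ≤ c) (s : ℝ) :
    ∫ x, Real.exp (s * g x) ∂μ ≤ Real.exp (s * ∫ x, g x ∂μ + c ^ 2 * s ^ 2 / 8) := by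
  obtain ⟨x₀⟩ : Nonempty α := nonempty_of_isProbabilityMeasure μ
  have hbdd : BddBelow (Set.range g) := ⟨g x₀ - c, by
    rintro _ ⟨y, rfl⟩
    have := (abs_le.mp (h x₀ y)).2
    linarith⟩
  have hsub := hasSubgaussianMGF_of_mem_Icc (μ := μ) (a := ⨅ x, g x) (b := (⨅ x, g x) + c)
    hg.aemeasurable (.of_forall fun x => ⟨ciInf_le hbdd x, by
      have : Nonempty α := ⟨x₀⟩
      have h1 : g x - c ≤ ⨅ y, g y := le_ciInf fun y => by
        have := (abs_le.mp (h x y)).2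
        linarith
      linarith⟩)
  have h1 := hsub.mgf_le s
  have h2 : ∀ x, Real.exp (s * (g x - ∫ y, g y ∂μ))
      = Real.exp (s * g x) * Real.exp (-(s * ∫ y, g y ∂μ)) := fun x => by
    rw [← Real.exp_add]; ring_nf
  simp only [mgf, h2] at h1
  rw [integral_mul_const, Real.exp_neg, ← div_eq_mul_inv, div_le_iff₀ (Real.exp_pos _),
    ← Real.exp_add] at h1
  refine h1.trans_eq (congrArg Real.exp ?_)
  simp only [add_sub_cancel_left, NNReal.coe_pow, NNReal.coe_div, coe_nnnorm, NNReal.coe_ofNat,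
    Real.norm_of_nonneg hc]
  ring

theorem integral_pi_succ {n : ℕ} (F : (Fin (n + 1) → α) → ℝ) :
    ∫ x, F x ∂(Measure.pi fun _ => μ)
      = ∫ p : α × (Fin n → α), F (Fin.cons p.1 p.2) ∂(μ.prod (Measure.pi fun _ => μ)) := by
  rw [← ((measurePreserving_piFinSuccAbove (fun _ : Fin (n + 1) => μ) 0).symm).integral_comp']
  simp_rw [MeasurableEquiv.piFinSuccAbove_symm_apply, Fin.insertNthEquiv, Fin.insertNth_zero]
  rfl

theorem measurable_cons {n : ℕ} :
    Measurable fun p : α × (Fin n → α) => (Fin.cons p.1 p.2 : Fin (n + 1) → α) := by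
  refine measurable_pi_lambda _ fun i => ?_
  refine Fin.cases ?_ (fun j => ?_) i
  · exact measurable_fst
  · exact (measurable_pi_apply j).comp measurable_snd

/-- The exponential moment form of McDiarmid's inequality. It follows by induction on the number
of variables: integrating out all variables but the first leaves a function of oscillation at
most `c`, to which Hoeffding's lemma applies. -/
theorem integral_exp_le_of_boundedDifferences {c M : ℝ} (hc : 0 ≤ c) (s : ℝ) :
    ∀ (n : ℕ) (f : (Fin n → α) → ℝ), Measurable f → (∀ x, |f x| ≤ M) →
      (∀ x i y, |f (Function.update x i y) - f x| ≤ c) →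
      ∫ x, Real.exp (s * f x) ∂(Measure.pi fun _ => μ)
        ≤ Real.exp (s * ∫ x, f x ∂(Measure.pi fun _ => μ) + n * (c ^ 2 * s ^ 2 / 8)) := by
  intro n
  induction n with
  | zero =>
    intro f _ _ _
    have h : ∀ x, f x = f default := fun x => by rw [Subsingleton.elim x default]
    simp [h]
  | succ n ih =>
    intro f hf hM hd
    have hbexp : ∀ {r : ℝ}, |r| ≤ M → |Real.exp (s * r)| ≤ Real.exp (|s| * M) := fun {r} hr => by
      rw [abs_of_pos (Real.exp_pos _), Real.exp_le_exp]
      calc s * r ≤ |s * r| := le_abs_self _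
        _ = |s| * |r| := abs_mul _ _
        _ ≤ |s| * M := mul_le_mul_of_nonneg_left hr (abs_nonneg _)
    have hfc : Measurable fun p : α × (Fin n → α) => f (Fin.cons p.1 p.2) :=
      hf.comp measurable_cons
    set g : α → ℝ := fun x => ∫ y, f (Fin.cons x y) ∂(Measure.pi fun _ : Fin n => μ) with hg
    have hgm : Measurable g := (hfc.stronglyMeasurable.integral_prod_right').measurable
    have hfx : ∀ x, Measurable fun y : Fin n → α => f (Fin.cons x y) := fun x =>
      hfc.comp measurable_prodMk_left
    have hint : ∀ x, Integrable (fun y : Fin n → α => f (Fin.cons x y))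
        (Measure.pi fun _ => μ) := fun x => integrable_of_abs_le (hfx x) fun y => hM _
    have hgM : ∀ x, |g x| ≤ M := fun x => by
      have := norm_integral_le_of_norm_le_const (μ := Measure.pi fun _ : Fin n => μ)
        (f := fun y => f (Fin.cons x y)) (C := M) (.of_forall fun y => hM _)
      simpa using this
    have hgd : ∀ x x', |g x - g x'| ≤ c := fun x x' => by
      rw [hg]
      dsimp only
      rw [← integral_sub (hint x) (hint x')]
      have := norm_integral_le_of_norm_le_const (μ := Measure.pi fun _ : Fin n => μ)
        (f := fun y => f (Fin.cons x y) - f (Fin.cons x' y)) (C := c) (.of_forall fun y => by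
          have := hd (Fin.cons x' y) 0 x
          rwa [Fin.update_cons_zero] at this)
      simpa using this
    have hintexp : Integrable
        (fun p : α × (Fin n → α) => Real.exp (s * f (Fin.cons p.1 p.2)))
        (μ.prod (Measure.pi fun _ => μ)) :=
      integrable_of_abs_le (Real.measurable_exp.comp (hfc.const_mul s)) fun p => hbexp (hM _)
    rw [integral_pi_succ, integral_pi_succ, integral_prod _ hintexp,
      integral_prod _ (integrable_of_abs_le hfc fun p => hM _)]
    calc ∫ x, ∫ y, Real.exp (s * f (Fin.cons x y)) ∂(Measure.pi fun _ => μ) ∂μ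
        ≤ ∫ x, Real.exp (s * g x) * Real.exp (n * (c ^ 2 * s ^ 2 / 8)) ∂μ := by
          refine integral_mono hintexp.integral_prod_left
            ((integrable_of_abs_le (Real.measurable_exp.comp (hgm.const_mul s))
              fun x => hbexp (hgM x)).mul_const _) fun x => ?_
          dsimp only
          rw [← Real.exp_add]
          refine ih (fun y => f (Fin.cons x y)) (hfx x) (fun y => hM _) fun y i z => ?_
          rw [Fin.cons_update]
          exact hd _ _ _
      _ = (∫ x, Real.exp (s * g x) ∂μ) * Real.exp (n * (c ^ 2 * s ^ 2 / 8)) :=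
          integral_mul_const _ _
      _ ≤ Real.exp (s * ∫ x, g x ∂μ + c ^ 2 * s ^ 2 / 8) * Real.exp (n * (c ^ 2 * s ^ 2 / 8)) :=
          mul_le_mul_of_nonneg_right (integral_exp_le_of_oscillation hgm hc hgd s)
            (Real.exp_pos _).le
      _ = Real.exp (s * ∫ x, g x ∂μ + (n + 1 : ℕ) * (c ^ 2 * s ^ 2 / 8)) := by
          rw [← Real.exp_add]; push_cast; ring_nf

/-- McDiarmid's inequality. -/
theorem measure_ge_le_of_boundedDifferences {n : ℕ} {f : (Fin n → α) → ℝ} (hf : Measurable f)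
    {c M : ℝ} (hc : 0 ≤ c) (hM : ∀ x, |f x| ≤ M)
    (hd : ∀ x i y, |f (Function.update x i y) - f x| ≤ c) {t : ℝ} (ht : 0 ≤ t) :
    (Measure.pi fun _ => μ).real {x | t ≤ f x - ∫ y, f y ∂(Measure.pi fun _ => μ)}
      ≤ Real.exp (-(2 * t ^ 2 / (n * c ^ 2))) := by
  have hsub : HasSubgaussianMGF (fun x => f x - ∫ y, f y ∂(Measure.pi fun _ => μ))
      (n * (c / 2).toNNReal ^ 2) (Measure.pi fun _ => μ) := by
    have h2 : ∀ s x, Real.exp (s * (f x - ∫ y, f y ∂(Measure.pi fun _ => μ)))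
        = Real.exp (s * f x) * Real.exp (-(s * ∫ y, f y ∂(Measure.pi fun _ => μ))) :=
      fun s x => by rw [← Real.exp_add]; ring_nf
    constructor
    · intro s
      simp only [h2]
      refine Integrable.mul_const (integrable_of_abs_le (M := Real.exp (|s| * M))
        (Real.measurable_exp.comp (hf.const_mul s)) fun x => ?_) _
      rw [Function.comp, abs_of_pos (Real.exp_pos _), Real.exp_le_exp]
      calc s * f x ≤ |s * f x| := le_abs_self _
        _ = |s| * |f x| := abs_mul _ _
        _ ≤ |s| * M := mul_le_mul_of_nonneg_left (hM x) (abs_nonneg _)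
    · intro s
      simp only [mgf, h2]
      rw [integral_mul_const, Real.exp_neg, ← div_eq_mul_inv, div_le_iff₀ (Real.exp_pos _),
        ← Real.exp_add]
      refine (integral_exp_le_of_boundedDifferences hc s n f hf hM hd).trans_eq
        (congrArg Real.exp ?_)
      rw [NNReal.coe_mul, NNReal.coe_pow, Real.coe_toNNReal _ (by positivity), NNReal.coe_natCast]
      ring
  refine (hsub.measure_ge_le ht).trans_eq (congrArg Real.exp ?_)
  rw [NNReal.coe_mul, NNReal.coe_pow, Real.coe_toNNReal _ (by positivity), NNReal.coe_natCast]
  by_cases h : (n : ℝ) * c ^ 2 = 0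
  · have h' : 2 * ((n : ℝ) * (c / 2) ^ 2) = 0 := by linear_combination h / 2
    rw [h, h']; simp
  · field_simp

/-- Concentration of the mean of `n` independent, identically distributed, centred random vectors:
its norm exceeds the bound `√(σ² / n)` for the root mean square by `t` only with exponentially
small probability. -/
theorem measure_norm_mean_ge_le {ι : Type*} [Fintype ι] {n : ℕ} (hn : 0 < n)
    {h : α → EuclideanSpace ℝ ι} (hm : Measurable h) {c σ2 : ℝ} (hc : ∀ x y, ‖h x - h y‖ ≤ c)
    (h0 : ∀ i, ∫ x, h x i ∂μ = 0) (hσ : ∑ i, ∫ x, (h x i) ^ 2 ∂μ ≤ σ2) {t : ℝ} (ht : 0 ≤ t) :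
    (Measure.pi fun _ => μ).real
        {x : Fin n → α | √(σ2 / n) + t ≤ ‖(n : ℝ)⁻¹ • ∑ j, h (x j)‖}
      ≤ Real.exp (-(2 * n * t ^ 2 / c ^ 2)) := by
  obtain ⟨x₀⟩ : Nonempty α := nonempty_of_isProbabilityMeasure μ
  have hn' : (0 : ℝ) < n := Nat.cast_pos.mpr hn
  have hc0 : 0 ≤ c := (norm_nonneg _).trans (hc x₀ x₀)
  set K := ‖h x₀‖ + c with hK
  have hhK : ∀ x, ‖h x‖ ≤ K := fun x => by
    have h1 := norm_add_le (h x₀) (h x - h x₀)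
    rw [add_sub_cancel] at h1
    linarith [hc x x₀]
  have hiK : ∀ i x, |h x i| ≤ K := fun i x => (PiLp.norm_apply_le _ i).trans (hhK x)
  have him : ∀ i, Measurable fun x => h x i := fun i => by fun_prop
  have hji : ∀ i j, Measurable fun x : Fin n → α => h (x j) i := fun i j =>
    (him i).comp (measurable_pi_apply j)
  set S : (Fin n → α) → EuclideanSpace ℝ ι := fun x => (n : ℝ)⁻¹ • ∑ j, h (x j) with hS
  have hSm : Measurable S := by
    have : Measurable fun x : Fin n → α => ∑ j, h (x j) :=
      Finset.measurable_fun_sum _ fun j _ => hm.comp (measurable_pi_apply j)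
    exact Measurable.const_smul this (n : ℝ)⁻¹
  have hSK : ∀ x, ‖S x‖ ≤ K := fun x => by
    rw [hS]
    dsimp only
    rw [norm_smul, norm_inv, Real.norm_natCast, inv_mul_le_iff₀ hn']
    refine (norm_sum_le _ _).trans ((Finset.sum_le_sum fun j _ => hhK (x j)).trans_eq ?_)
    simp
  have hSi : ∀ i x, S x i = (n : ℝ)⁻¹ * ∑ j, h (x j) i := fun i x => by
    simp [hS]
  set P : Measure (Fin n → α) := Measure.pi fun _ => μ with hP
  -- second moments of the coordinates of the mean
  have hvar : ∀ i, ∫ x, (S x i) ^ 2 ∂P = (n : ℝ)⁻¹ * ∫ x, (h x i) ^ 2 ∂μ := fun i => by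
    have hLp : MemLp (fun x => h x i) 2 μ :=
      MemLp.of_bound (him i).aestronglyMeasurable K (.of_forall fun x => hiK i x)
    have h1 := variance_sum_pi (ι := Fin n) (μ := fun _ => μ) (X := fun _ x => h x i)
      fun _ => hLp
    have e : (∑ j, fun ω : Fin n → α => h (ω j) i) = fun ω => ∑ j, h (ω j) i := by
      ext ω; simp
    rw [e] at h1
    have h2 : ∫ x : Fin n → α, ∑ j, h (x j) i ∂P = 0 := by
      rw [integral_finsetSum _ fun j _ => integrable_of_abs_le (hji i j) fun x => hiK i _]
      refine Finset.sum_eq_zero fun j _ => ?_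
      rw [hP, integral_comp_eval (μ := fun _ => μ) (f := fun x => h x i)
        (him i).aestronglyMeasurable, h0]
    rw [variance_of_integral_eq_zero
      (Finset.measurable_fun_sum _ fun j _ => hji i j).aemeasurable h2] at h1
    simp only [variance_of_integral_eq_zero (him i).aemeasurable (h0 i), Finset.sum_const,
      Finset.card_univ, Fintype.card_fin, nsmul_eq_mul] at h1
    simp only [hSi, mul_pow]
    rw [integral_const_mul, h1]
    field_simp
  have hS2 : ∫ x, ‖S x‖ ^ 2 ∂P ≤ σ2 / n := by
    have h1 : ∀ x, ‖S x‖ ^ 2 = ∑ i, (S x i) ^ 2 := fun x => by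
      rw [EuclideanSpace.norm_sq_eq]
      simp
    simp only [h1]
    rw [integral_finsetSum _ fun i _ => integrable_of_abs_le (M := K ^ 2)
      (by fun_prop) fun x => ?_]
    · simp only [hvar, ← Finset.mul_sum]
      rw [div_eq_inv_mul]
      exact mul_le_mul_of_nonneg_left hσ (inv_pos.mpr hn').le
    · rw [abs_pow]
      exact pow_le_pow_left₀ (abs_nonneg _)
        ((PiLp.norm_apply_le _ i).trans (hSK x)) 2
  have hE : ∫ x, ‖S x‖ ∂P ≤ √(σ2 / n) := by
    refine Real.le_sqrt_of_sq_le (le_trans ?_ hS2)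
    have hLp : MemLp (fun x => ‖S x‖) 2 P :=
      MemLp.of_bound hSm.norm.aestronglyMeasurable K (.of_forall fun x => by simpa using hSK x)
    have h1 := variance_nonneg (fun x => ‖S x‖) P
    rw [variance_eq_sub hLp] at h1
    simpa using h1
  have hd : ∀ x i y, |‖S (Function.update x i y)‖ - ‖S x‖| ≤ c / n := fun x i y => by
    refine (abs_norm_sub_norm_le _ _).trans ?_
    have h1 : S (Function.update x i y) - S x = (n : ℝ)⁻¹ • (h y - h (x i)) := by
      rw [hS]
      dsimp only
      rw [← smul_sub, ← Finset.sum_sub_distrib, Finset.sum_eq_single i]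
      · rw [Function.update_self]
      · intro j _ hj
        rw [Function.update_of_ne hj, sub_self]
      · simp
    rw [h1, norm_smul, norm_inv, Real.norm_natCast, div_eq_inv_mul]
    exact mul_le_mul_of_nonneg_left (hc _ _) (inv_pos.mpr hn').le
  have key := measure_ge_le_of_boundedDifferences (μ := μ) hSm.norm (div_nonneg hc0 hn'.le)
    (fun x => by rw [abs_norm]; exact hSK x) hd ht
  refine (measureReal_mono fun x hx => ?_).trans (key.trans_eq (congrArg Real.exp ?_))
  · have hx' : √(σ2 / n) + t ≤ ‖S x‖ := hx
    change t ≤ ‖S x‖ - ∫ y, ‖S y‖ ∂P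
    linarith
  · by_cases h : c = 0
    · simp [h]
    · field_simp

end BoundedDifferences

/-! ### Concentration of standardized data -/

section Concentration

variable {α : Type*} [MeasurableSpace α] {μ : Measure α}

/-- The matrix `z zᵀ - 1` as a vector; the norm of this space is the Frobenius norm. -/
def outerSubOne (z : Fin d → ℝ) : EuclideanSpace ℝ (Fin d × Fin d) :=
  WithLp.toLp 2 fun p => z p.1 * z p.2 - (1 : Matrix (Fin d) (Fin d) ℝ) p.1 p.2

theorem norm_toLp_sq (x : Fin d → ℝ) : ‖WithLp.toLp 2 x‖ ^ 2 = x ⬝ᵥ x := euclNorm_sq x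

theorem sum_outer_mul_outer (x y : Fin d → ℝ) :
    ∑ p : Fin d × Fin d, (x p.1 * x p.2) * (y p.1 * y p.2) = (x ⬝ᵥ y) ^ 2 := by
  rw [sq, dotProduct, Finset.sum_mul_sum, Fintype.sum_prod_type]
  exact Finset.sum_congr rfl fun i _ => Finset.sum_congr rfl fun j _ => by ring

/-- The Frobenius distance of two matrices `x xᵀ`, `y yᵀ`. The constant `√2`, instead of the `2` of
the triangle inequality, is what the constant `beta1` needs. -/
theorem norm_outerSubOne_sub_le {x y : Fin d → ℝ} {r : ℝ} (hx : x ⬝ᵥ x ≤ r)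
    (hy : y ⬝ᵥ y ≤ r) : ‖outerSubOne x - outerSubOne y‖ ≤ √2 * r := by
  have hx0 : 0 ≤ x ⬝ᵥ x := by rw [← euclNorm_sq]; positivity
  have hy0 : 0 ≤ y ⬝ᵥ y := by rw [← euclNorm_sq]; positivity
  have hr : 0 ≤ r := hx0.trans hx
  refine le_of_sq_le_sq ?_ (by positivity)
  have h1 : ‖outerSubOne x - outerSubOne y‖ ^ 2
      = (x ⬝ᵥ x) ^ 2 - 2 * (x ⬝ᵥ y) ^ 2 + (y ⬝ᵥ y) ^ 2 := by
    rw [EuclideanSpace.norm_sq_eq, ← sum_outer_mul_outer, ← sum_outer_mul_outer,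
      ← sum_outer_mul_outer, Finset.mul_sum, ← Finset.sum_sub_distrib, ← Finset.sum_add_distrib]
    refine Finset.sum_congr rfl fun p _ => ?_
    simp only [outerSubOne, PiLp.sub_apply, Real.norm_eq_abs, sq_abs]
    ring
  rw [h1, mul_pow, Real.sq_sqrt zero_le_two]
  nlinarith [sq_nonneg (x ⬝ᵥ y)]

/-- The standardized data that the concentration bounds are about: bounded by `R`, centred, and
with the identity as covariance matrix. -/
structure IsStandardized (μ : Measure α) (R : ℝ) (z : α → Fin d → ℝ) : Prop where
  measurable : Measurable z
  bound : ∀ x, z x ⬝ᵥ z x ≤ R ^ 2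
  mean : ∀ i, ∫ x, z x i ∂μ = 0
  cov : ∀ i j, ∫ x, z x i * z x j ∂μ = (1 : Matrix (Fin d) (Fin d) ℝ) i j

namespace IsStandardized

variable {R : ℝ} {z : α → Fin d → ℝ}

theorem measurable_apply (hz : IsStandardized μ R z) (i : Fin d) : Measurable fun x => z x i :=
  (measurable_pi_apply i).comp hz.measurable

theorem abs_apply_le (hz : IsStandardized μ R z) (i : Fin d) (x : α) : |z x i| ≤ |R| := by
  refine sq_le_sq.mp (le_trans ?_ (hz.bound x))
  rw [dotProduct, sq]
  exact Finset.single_le_sum (f := fun i => z x i * z x i) (fun i _ => mul_self_nonneg _)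
    (Finset.mem_univ i)

theorem abs_mul_le (hz : IsStandardized μ R z) (i j : Fin d) (x : α) :
    |z x i * z x j| ≤ |R| * |R| := by
  rw [abs_mul]
  exact mul_le_mul (hz.abs_apply_le i x) (hz.abs_apply_le j x) (abs_nonneg _) (abs_nonneg _)

/-- In positive dimension the unit covariance excludes `R = 0`. -/
theorem sq_pos [IsProbabilityMeasure μ] (hz : IsStandardized μ R z) (hd : 0 < d) : 0 < R ^ 2 := by
  have h1 := hz.cov ⟨0, hd⟩ ⟨0, hd⟩
  rw [Matrix.one_apply_eq] at h1
  by_contra hR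
  have hR0 : R = 0 := by
    have : R ^ 2 = 0 := le_antisymm (not_lt.mp hR) (sq_nonneg R)
    exact pow_eq_zero_iff (two_ne_zero) |>.mp this
  have h2 : ∀ x, z x ⟨0, hd⟩ = 0 := fun x => by
    have := hz.abs_apply_le ⟨0, hd⟩ x
    rw [hR0, abs_zero] at this
    exact abs_nonpos_iff.mp this
  simp [h2] at h1

/-- The bounded differences are `2 |R| / N`, and the root mean square is at most `|R| / √N`. -/
theorem measure_mean_le [IsProbabilityMeasure μ] (hz : IsStandardized μ R z) (hd : 0 < d) (hN : 0 < N) {L : ℝ}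
    (hL : 0 ≤ L) :
    (Measure.pi fun _ => μ).real {x : Fin N → α |
        √(R ^ 2 / N) * (1 + √(2 * L)) ≤ ‖(N : ℝ)⁻¹ • ∑ j, WithLp.toLp 2 (z (x j))‖}
      ≤ Real.exp (-L) := by
  have hN' : (0 : ℝ) < N := Nat.cast_pos.mpr hN
  have hR := hz.sq_pos hd
  have hn : ∀ x, ‖WithLp.toLp 2 (z x)‖ ≤ |R| := fun x =>
    abs_le_of_sq_le_sq' (by rw [norm_toLp_sq, sq_abs]; exact hz.bound x) (abs_nonneg R) |>.2
  have hm : Measurable fun x => WithLp.toLp 2 (z x) :=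
    (WithLp.measurable_toLp 2 _).comp hz.measurable
  have hc : ∀ x y, ‖WithLp.toLp 2 (z x) - WithLp.toLp 2 (z y)‖ ≤ 2 * |R| := fun x y =>
    (norm_sub_le _ _).trans (by linarith [hn x, hn y])
  have hσ : ∑ i, ∫ x, (z x i) ^ 2 ∂μ ≤ R ^ 2 := by
    rw [← integral_finsetSum _ fun i _ => integrable_of_abs_le (M := |R| * |R|)
      ((hz.measurable_apply i).pow_const 2) fun x => by rw [sq]; exact hz.abs_mul_le i i x]
    have h1 : ∀ x, ∑ i, (z x i) ^ 2 = z x ⬝ᵥ z x := fun x =>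
      Finset.sum_congr rfl fun i _ => sq _
    simp only [h1]
    have h2 : Measurable fun x => z x ⬝ᵥ z x := by
      simp only [dotProduct]
      exact Finset.measurable_fun_sum _ fun i _ =>
        (hz.measurable_apply i).mul (hz.measurable_apply i)
    have h3 : ∀ x, 0 ≤ z x ⬝ᵥ z x := fun x => by rw [← norm_toLp_sq]; positivity
    have := integral_mono (μ := μ) (integrable_of_abs_le (M := R ^ 2) h2 fun x => by
      rw [abs_of_nonneg (h3 x)]; exact hz.bound x) (integrable_const (R ^ 2)) hz.bound
    simpa using this
  have key := measure_norm_mean_ge_le (μ := μ) hN hm hc hz.mean hσ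
    (t := √(R ^ 2 / N) * √(2 * L)) (by positivity)
  rw [← mul_one_add] at key
  refine key.trans_eq (congrArg Real.exp ?_)
  rw [mul_pow, mul_pow, Real.sq_sqrt (by positivity), Real.sq_sqrt (by positivity), sq_abs]
  have : R ≠ 0 := fun h => by simp [h] at hR
  field_simp

/-- The bounded differences are `√2 R² / N`, and the mean square is at most `(R⁴ - d) / N`, since the
expectation of `‖z zᵀ - 1‖²` is that of `‖z‖⁴` minus `d`. -/
theorem measure_secondMoment_le [IsProbabilityMeasure μ] (hz : IsStandardized μ R z) (hd : 0 < d) (hN : 0 < N) {L : ℝ}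
    (hL : 0 ≤ L) :
    (Measure.pi fun _ => μ).real {x : Fin N → α |
        R ^ 2 / √N * (√(1 - d / R ^ 4) + √L) ≤ ‖(N : ℝ)⁻¹ • ∑ j, outerSubOne (z (x j))‖}
      ≤ Real.exp (-L) := by
  have hN' : (0 : ℝ) < N := Nat.cast_pos.mpr hN
  have hR := hz.sq_pos hd
  have hp : ∀ p : Fin d × Fin d, Measurable fun x => z x p.1 * z x p.2 := fun p =>
    (hz.measurable_apply p.1).mul (hz.measurable_apply p.2)
  have hpi : ∀ p : Fin d × Fin d, Integrable (fun x => z x p.1 * z x p.2) μ := fun p =>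
    integrable_of_abs_le (hp p) (hz.abs_mul_le p.1 p.2)
  have hm : Measurable fun x => outerSubOne (z x) :=
    (WithLp.measurable_toLp 2 _).comp
      (measurable_pi_lambda _ fun p => (hp p).sub_const _)
  have h0 : ∀ p, ∫ x, outerSubOne (z x) p ∂μ = 0 := fun p => by
    simp only [outerSubOne]
    rw [integral_sub (hpi p) (integrable_const _), hz.cov]
    simp
  have hsq : ∀ p : Fin d × Fin d, Integrable (fun x => (z x p.1 * z x p.2) ^ 2) μ := fun p =>
    integrable_of_abs_le (M := (|R| * |R|) ^ 2) ((hp p).pow_const 2) fun x => by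
      rw [abs_pow]
      exact pow_le_pow_left₀ (abs_nonneg _) (hz.abs_mul_le p.1 p.2 x) 2
  have hσ : ∑ p, ∫ x, (outerSubOne (z x) p) ^ 2 ∂μ ≤ R ^ 4 - d := by
    have h1 : ∀ p : Fin d × Fin d, ∫ x, (outerSubOne (z x) p) ^ 2 ∂μ
        = ∫ x, (z x p.1 * z x p.2) ^ 2 ∂μ - (1 : Matrix (Fin d) (Fin d) ℝ) p.1 p.2 := fun p => by
      have h2 : (1 : Matrix (Fin d) (Fin d) ℝ) p.1 p.2 ^ 2
          = (1 : Matrix (Fin d) (Fin d) ℝ) p.1 p.2 := by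
        rw [Matrix.one_apply]; split_ifs <;> norm_num
      have h3 := hz.cov p.1 p.2
      simp only [outerSubOne]
      generalize (1 : Matrix (Fin d) (Fin d) ℝ) p.1 p.2 = δ at h2 h3 ⊢
      have e : ∀ x, (z x p.1 * z x p.2 - δ) ^ 2
          = (z x p.1 * z x p.2) ^ 2 - 2 * δ * (z x p.1 * z x p.2) + δ ^ 2 := fun x => by ring
      have h4 : Integrable (fun x => 2 * δ * (z x p.1 * z x p.2)) μ := (hpi p).const_mul _
      have h5 : Integrable (fun x => (z x p.1 * z x p.2) ^ 2 - 2 * δ * (z x p.1 * z x p.2)) μ :=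
        (hsq p).sub h4
      simp only [e]
      rw [integral_add h5 (integrable_const _), integral_sub (hsq p) h4, integral_const_mul, h3]
      simp only [integral_const, probReal_univ, smul_eq_mul]
      linear_combination -h2
    simp only [h1]
    rw [Finset.sum_sub_distrib, ← integral_finsetSum _ fun p _ => hsq p]
    have h2 : ∑ p : Fin d × Fin d, (1 : Matrix (Fin d) (Fin d) ℝ) p.1 p.2 = d := by
      rw [Fintype.sum_prod_type]
      simp [Matrix.one_apply]
    have h3 : ∀ x, ∑ p : Fin d × Fin d, (z x p.1 * z x p.2) ^ 2 = (z x ⬝ᵥ z x) ^ 2 := fun x => by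
      rw [← sum_outer_mul_outer]
      exact Finset.sum_congr rfl fun p _ => sq _
    have h4 : ∀ x, ∑ p : Fin d × Fin d, (z x p.1 * z x p.2) ^ 2 ≤ R ^ 4 := fun x => by
      have h5 : 0 ≤ z x ⬝ᵥ z x := by rw [← norm_toLp_sq]; positivity
      rw [h3]
      calc (z x ⬝ᵥ z x) ^ 2 ≤ (R ^ 2) ^ 2 := pow_le_pow_left₀ h5 (hz.bound x) 2
        _ = R ^ 4 := by ring
    have h6 := integral_mono (μ := μ) (integrable_finsetSum _ fun p _ => hsq p)
      (integrable_const (R ^ 4)) h4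
    rw [h2]
    simpa using h6
  have key := measure_norm_mean_ge_le (μ := μ) hN hm
    (fun x y => norm_outerSubOne_sub_le (hz.bound x) (hz.bound y)) h0 hσ
    (t := R ^ 2 / √N * √L) (by positivity)
  have h1 : √((R ^ 4 - d) / N) = R ^ 2 / √N * √(1 - d / R ^ 4) := by
    have e : (R ^ 4 - d) / N = (R ^ 2) ^ 2 / N * (1 - d / R ^ 4) := by
      have : R ≠ 0 := fun h => by simp [h] at hR
      field_simp
    rw [e, Real.sqrt_mul (by positivity), Real.sqrt_div (by positivity), Real.sqrt_sq hR.le]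
  rw [h1, ← mul_add] at key
  refine key.trans_eq (congrArg Real.exp ?_)
  have : R ≠ 0 := fun h => by simp [h] at hR
  rw [mul_pow, mul_pow, div_pow, Real.sq_sqrt hL, Real.sq_sqrt hN'.le, Real.sq_sqrt zero_le_two]
  field_simp

end IsStandardized

end Concentration

/-! ### The sample covariance and the confidence region -/

theorem sampleCov_transpose (x : Fin N → Fin d → ℝ) : (sampleCov x)ᵀ = sampleCov x := by
  simp only [sampleCov, transpose_smul, transpose_sum, transpose_vecMulVec]

theorem sampleMean_sub_dotProduct (hN : 0 < N) (x : Fin N → Fin d → ℝ) (c l : Fin d → ℝ) :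
    (sampleMean x - c) ⬝ᵥ l = (N : ℝ)⁻¹ * ∑ j, (x j - c) ⬝ᵥ l := by
  have hN' : (N : ℝ) ≠ 0 := Nat.cast_ne_zero.mpr hN.ne'
  simp only [sampleMean, sub_dotProduct, smul_dotProduct, sum_dotProduct, smul_eq_mul,
    Finset.sum_sub_distrib, Finset.sum_const, Finset.card_univ, Fintype.card_fin, nsmul_eq_mul]
  field_simp

/-- The decomposition of the second moment of the sample about `c` into variance and bias. -/
theorem sampleCov_quadForm (hN : 0 < N) (x : Fin N → Fin d → ℝ) (c l : Fin d → ℝ) :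
    l ⬝ᵥ (sampleCov x *ᵥ l)
      = (N : ℝ)⁻¹ * ∑ j, ((x j - c) ⬝ᵥ l) ^ 2 - ((sampleMean x - c) ⬝ᵥ l) ^ 2 := by
  have hN' : (N : ℝ) ≠ 0 := Nat.cast_ne_zero.mpr hN.ne'
  have h1 := sampleMean_sub_dotProduct hN x c l
  have h2 : ∀ j, (x j - sampleMean x) ⬝ᵥ l = (x j - c) ⬝ᵥ l - (sampleMean x - c) ⬝ᵥ l :=
    fun j => by rw [← sub_dotProduct]; congr 1; abel
  simp only [sampleCov, smul_mulVec, sum_mulVec, dotProduct_smul, dotProduct_sum,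
    dotProduct_vecMulVec_mulVec, smul_eq_mul, h2]
  generalize (sampleMean x - c) ⬝ᵥ l = m at *
  have h3 : ∑ j, ((x j - c) ⬝ᵥ l - m) * ((x j - c) ⬝ᵥ l - m)
      = ∑ j, ((x j - c) ⬝ᵥ l) ^ 2 - 2 * m * (∑ j, (x j - c) ⬝ᵥ l) + N * m ^ 2 := by
    have : ∀ j, ((x j - c) ⬝ᵥ l - m) * ((x j - c) ⬝ᵥ l - m)
        = ((x j - c) ⬝ᵥ l) ^ 2 - 2 * m * ((x j - c) ⬝ᵥ l) + m ^ 2 := fun j => by ring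
    simp only [this, Finset.sum_add_distrib, Finset.sum_sub_distrib, ← Finset.mul_sum,
      Finset.sum_const, Finset.card_univ, Fintype.card_fin, nsmul_eq_mul]
  have h4 : ∑ j, (x j - c) ⬝ᵥ l = N * m := by rw [h1]; field_simp
  rw [h3, h4]
  field_simp
  ring

theorem sampleMean_mem_Icc (hN : 0 < N) {a b : Fin d → ℝ} {x : Fin N → Fin d → ℝ}
    (hx : ∀ j, x j ∈ Set.Icc a b) : sampleMean x ∈ Set.Icc a b := by
  have hN' : (N : ℝ) ≠ 0 := Nat.cast_ne_zero.mpr hN.ne'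
  rw [sampleMean, Finset.smul_sum]
  refine (convex_Icc a b).sum_mem (fun _ _ => by positivity) ?_ fun j _ => hx j
  simp [hN']

theorem posSemidef_momentAbout {a b : Fin d → ℝ} {P : Measure (Fin d → ℝ)} [IsFiniteMeasure P]
    (h : ∀ᵐ u ∂P, u ∈ Set.Icc a b) (c : Fin d → ℝ) : (momentAbout P c).PosSemidef :=
  posSemidef_real_iff.mpr ⟨momentAbout_transpose P c, fun l => by
    rw [momentAbout_quadForm h]
    exact integral_nonneg fun u => sq_nonneg _⟩

theorem mem_PDY_of_testAccepts {a b : Fin d → ℝ} {P : Measure (Fin d → ℝ)}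
    [IsProbabilityMeasure P] (h : ∀ᵐ u ∂P, u ∈ Set.Icc a b) {x : Fin N → Fin d → ℝ}
    {γ₁ γ₂ : ℝ} (hx : TestAccepts x γ₁ γ₂ (meanVec P) (covMat P)) :
    P ∈ PDY a b (sampleMean x) (sampleCov x) γ₁ γ₂ := by
  obtain ⟨hS, h1, h2⟩ := hx
  refine ⟨inferInstance, h, ?_, posSemidef_real_iff.mpr ⟨?_, fun l => ?_⟩⟩
  · rwa [← neg_sub, mulVec_neg, neg_dotProduct, dotProduct_neg, neg_neg]
  · rw [transpose_sub, transpose_smul, sampleCov_transpose, momentAbout_transpose]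
  · rw [sub_mulVec, smul_mulVec, dotProduct_sub, dotProduct_smul, smul_eq_mul, sub_nonneg]
    by_cases hl : l = 0
    · simp [hl]
    have hpos := (posDef_real_iff.mp hS).2
    obtain ⟨K, hK⟩ := exists_quadForm_le hS (posSemidef_momentAbout h (sampleMean x))
    rw [covStat, ← momentAbout_eq_covMat_add h] at h2
    have hbdd : BddAbove (Set.range fun l : Fin d → ℝ =>
        (l ⬝ᵥ (momentAbout P (sampleMean x) *ᵥ l)) / (l ⬝ᵥ (sampleCov x *ᵥ l))) := by
      refine ⟨max K 0, ?_⟩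
      rintro _ ⟨k, rfl⟩
      by_cases hk : k = 0
      · simp [hk]
      · exact le_max_of_le_left ((div_le_iff₀ (hpos k hk)).mpr (hK k))
    exact (div_le_iff₀ (hpos l hl)).mp ((le_ciSup hbdd l).trans h2)

/-- If the sample is close to the distribution `P` in the sense of the two concentration bounds,
then the sample covariance is positive definite and `P` lies in the confidence region with the
thresholds of Delage and Ye. -/
theorem mem_PDY_of_concentration (hN : 0 < N) {a b : Fin d → ℝ} {P : Measure (Fin d → ℝ)}
    [IsProbabilityMeasure P] (h : ∀ᵐ u ∂P, u ∈ Set.Icc a b) (hP : (covMat P).PosDef)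
    {x : Fin N → Fin d → ℝ} {b₁ b₂ : ℝ} (hb₂ : 0 ≤ b₂) (hb : 0 < 1 - b₁ - b₂)
    (h1 : ∀ l, ((sampleMean x - meanVec P) ⬝ᵥ l) ^ 2 ≤ b₂ * (l ⬝ᵥ (covMat P *ᵥ l)))
    (h2 : ∀ l, (1 - b₁) * (l ⬝ᵥ (covMat P *ᵥ l))
      ≤ (N : ℝ)⁻¹ * ∑ j, ((x j - meanVec P) ⬝ᵥ l) ^ 2) :
    (sampleCov x).PosDef ∧
      P ∈ PDY a b (sampleMean x) (sampleCov x) (b₂ / (1 - b₁ - b₂))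
        ((1 + b₂) / (1 - b₁ - b₂)) := by
  have key : ∀ l, (1 - b₁ - b₂) * (l ⬝ᵥ (covMat P *ᵥ l)) ≤ l ⬝ᵥ (sampleCov x *ᵥ l) := fun l => by
    rw [sampleCov_quadForm hN x (meanVec P)]
    linarith [h1 l, h2 l]
  have hS : (sampleCov x).PosDef := posDef_real_iff.mpr ⟨sampleCov_transpose x, fun l hl =>
    (mul_pos hb ((posDef_real_iff.mp hP).2 l hl)).trans_le (key l)⟩
  have hSdet : IsUnit (sampleCov x).det := (isUnit_iff_isUnit_det _).mp hS.isUnit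
  refine ⟨hS, inferInstance, h, ?_, posSemidef_real_iff.mpr ⟨?_, fun l => ?_⟩⟩
  · set e := meanVec P - sampleMean x with he
    set z := (sampleCov x)⁻¹ *ᵥ e with hz
    have hz1 : z ⬝ᵥ (sampleCov x *ᵥ z) = e ⬝ᵥ z := by
      rw [hz, mulVec_mulVec, mul_nonsing_inv _ hSdet, one_mulVec, dotProduct_comm]
    have h3 := h1 z
    have h4 : (sampleMean x - meanVec P) ⬝ᵥ z = -(e ⬝ᵥ z) := by
      rw [← neg_sub, neg_dotProduct]
    have h5 := key z
    rw [hz1] at h5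
    rw [h4, neg_sq] at h3
    rw [le_div_iff₀ hb]
    have h6 : 0 ≤ e ⬝ᵥ z := hz1 ▸ (posSemidef_real_iff.mp hS.posSemidef).2 z
    rcases h6.eq_or_lt with h7 | h7
    · rw [← h7, zero_mul]; exact hb₂
    · refine le_of_mul_le_mul_right ?_ h7
      nlinarith [mul_le_mul_of_nonneg_left h3 hb.le, mul_le_mul_of_nonneg_left h5 hb₂]
  · rw [transpose_sub, transpose_smul, sampleCov_transpose, momentAbout_transpose]
  · rw [sub_mulVec, smul_mulVec, dotProduct_sub, dotProduct_smul, smul_eq_mul, sub_nonneg,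
      momentAbout_eq_covMat_add h, add_mulVec, dotProduct_add, dotProduct_vecMulVec_mulVec,
      div_mul_eq_mul_div, le_div_iff₀ hb]
    have h3 := h1 l
    have h4 : (meanVec P - sampleMean x) ⬝ᵥ l = -((sampleMean x - meanVec P) ⬝ᵥ l) := by
      rw [← neg_sub, neg_dotProduct]
    rw [h4]
    nlinarith [mul_le_mul_of_nonneg_left (key l) (by linarith : 0 ≤ 1 + b₂),
      mul_le_mul_of_nonneg_left h3 hb.le]

theorem holdsWithProbAtLeast_of_sample {Ω : Type*} [MeasurableSpace Ω] {Q : Measure Ω}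
    [IsProbabilityMeasure Q] {P : Measure (Fin d → ℝ)} {X : Fin N → Ω → Fin d → ℝ}
    (hX : ∀ j, Measurable (X j)) (hlaw : ∀ j, Q.map (X j) = P) (hindep : iIndepFun X Q)
    {p : ℝ} {G : Set (Fin N → Fin d → ℝ)} (hG : MeasurableSet G)
    (hp : p ≤ (Measure.pi fun _ : Fin N => P).real G) {S : Ω → Prop}
    (hS : ∀ ω, (fun j => X j ω) ∈ G → S ω) : HoldsWithProbAtLeast Q p S := by
  have hm : Measurable fun ω j => X j ω := measurable_pi_lambda _ hX
  refine ⟨(fun ω j => X j ω) ⁻¹' G, hm hG, ?_, hS⟩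
  have h1 := (iIndepFun_iff_map_fun_eq_pi_map fun j => (hX j).aemeasurable).mp hindep
  simp only [hlaw] at h1
  rw [← Measure.map_apply hm hG, h1]
  exact (ENNReal.ofReal_le_ofReal hp).trans ENNReal.ofReal_toReal_le

/-! ### The thresholds of Delage and Ye -/

/-- A distribution that is supported in the ellipsoid of radius `R` about its mean can be
standardized by a linear map. The map is cut off outside the ellipsoid, a null set, so that the
bound holds everywhere, as the method of bounded differences requires. -/
theorem exists_isStandardized {a b : Fin d → ℝ} {P : Measure (Fin d → ℝ)}
    [IsProbabilityMeasure P] (h : ∀ᵐ u ∂P, u ∈ Set.Icc a b) (hP : (covMat P).PosDef) {R : ℝ}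
    (hR : ∀ᵐ u ∂P, (u - meanVec P) ⬝ᵥ ((covMat P)⁻¹ *ᵥ (u - meanVec P)) ≤ R ^ 2)
    {D : Matrix (Fin d) (Fin d) ℝ} (hD : Dᵀ * D = (covMat P)⁻¹) :
    ∃ z : (Fin d → ℝ) → Fin d → ℝ, IsStandardized P R z ∧
      ∀ᵐ u ∂P, z u = D *ᵥ (u - meanVec P) := by
  classical
  set S := {u : Fin d → ℝ | (u - meanVec P) ⬝ᵥ ((covMat P)⁻¹ *ᵥ (u - meanVec P)) ≤ R ^ 2} with hS
  have hSm : MeasurableSet S :=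
    (isClosed_le (by fun_prop) continuous_const).measurableSet
  have hae : ∀ᵐ u ∂P, S.indicator (fun u => D *ᵥ (u - meanVec P)) u = D *ᵥ (u - meanVec P) :=
    hR.mono fun u hu => Set.indicator_of_mem (s := S) hu _
  have hrow : ∀ u i, (D *ᵥ (u - meanVec P)) i = (u - meanVec P) ⬝ᵥ D i := fun u i => by
    rw [dotProduct_comm]; rfl
  refine ⟨S.indicator fun u => D *ᵥ (u - meanVec P), ⟨?_, fun u => ?_, fun i => ?_, fun i j => ?_⟩,
    hae⟩
  · exact Measurable.indicator (by fun_prop : Continuous _).measurable hSm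
  · by_cases hu : u ∈ S
    · rw [Set.indicator_of_mem hu, ← euclNorm_sq, euclNorm_mulVec_sq hD]
      exact hu
    · rw [Set.indicator_of_notMem hu, zero_dotProduct]
      exact sq_nonneg R
  · have h1 : ∀ᵐ u ∂P, S.indicator (fun u => D *ᵥ (u - meanVec P)) u i
        = u ⬝ᵥ D i - meanVec P ⬝ᵥ D i := hae.mono fun u hu => by
      rw [hu, hrow, sub_dotProduct]
    rw [integral_congr_ae h1, integral_sub (integrable_of_box h (by fun_prop))
      (integrable_const _), ← meanVec_dotProduct h]
    simp
  · have h1 : ∀ᵐ u ∂P, S.indicator (fun u => D *ᵥ (u - meanVec P)) u i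
        * S.indicator (fun u => D *ᵥ (u - meanVec P)) u j
        = ((u - meanVec P) ⬝ᵥ D i) * ((u - meanVec P) ⬝ᵥ D j) := hae.mono fun u hu => by
      rw [hu, hrow, hrow]
    rw [integral_congr_ae h1, ← momentAbout_bilin h, ← mul_mul_transpose_eq_one hP.isUnit hD,
      Matrix.mul_assoc, mul_apply, dotProduct]
    refine Finset.sum_congr rfl fun k _ => ?_
    rfl

theorem sq_mean_dotProduct_le (ζ : Fin N → Fin d → ℝ) (y : Fin d → ℝ) :
    ((N : ℝ)⁻¹ * ∑ j, ζ j ⬝ᵥ y) ^ 2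
      ≤ ‖(N : ℝ)⁻¹ • ∑ j, WithLp.toLp 2 (ζ j)‖ ^ 2 * (y ⬝ᵥ y) := by
  have h1 : (N : ℝ)⁻¹ * ∑ j, ζ j ⬝ᵥ y = ((N : ℝ)⁻¹ • ∑ j, ζ j) ⬝ᵥ y := by
    rw [smul_dotProduct, sum_dotProduct, smul_eq_mul]
  have h2 : (N : ℝ)⁻¹ • ∑ j, WithLp.toLp 2 (ζ j) = WithLp.toLp 2 ((N : ℝ)⁻¹ • ∑ j, ζ j) := by
    rw [WithLp.toLp_smul, WithLp.toLp_sum]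
  have h3 := pow_le_pow_left₀ (abs_nonneg _)
    (abs_dotProduct_le_euclNorm ((N : ℝ)⁻¹ • ∑ j, ζ j) y) 2
  rw [sq_abs, mul_pow, euclNorm_sq y] at h3
  rw [h1, h2]
  exact h3

/-- The Frobenius norm of the deviation from the identity bounds the quadratic form of the second
moment matrix of `ζ` from below. -/
theorem le_mean_sq_dotProduct (hN : 0 < N) (ζ : Fin N → Fin d → ℝ) (y : Fin d → ℝ) :
    (1 - ‖(N : ℝ)⁻¹ • ∑ j, outerSubOne (ζ j)‖) * (y ⬝ᵥ y)
      ≤ (N : ℝ)⁻¹ * ∑ j, (ζ j ⬝ᵥ y) ^ 2 := by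
  have hN' : (N : ℝ) ≠ 0 := Nat.cast_ne_zero.mpr hN.ne'
  set Y : EuclideanSpace ℝ (Fin d × Fin d) := WithLp.toLp 2 fun p => y p.1 * y p.2 with hY
  have h0 : 0 ≤ y ⬝ᵥ y := by rw [← euclNorm_sq]; positivity
  have hYn : ‖Y‖ = y ⬝ᵥ y := by
    rw [← Real.sqrt_sq (norm_nonneg Y), ← Real.sqrt_sq h0, EuclideanSpace.norm_sq_eq,
      ← sum_outer_mul_outer]
    congr 1
    exact Finset.sum_congr rfl fun p _ => by rw [hY, Real.norm_eq_abs, sq_abs, sq]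
  have h1 : ∀ j, inner ℝ Y (outerSubOne (ζ j)) = (ζ j ⬝ᵥ y) ^ 2 - y ⬝ᵥ y := fun j => by
    have e : ∑ p : Fin d × Fin d, (1 : Matrix (Fin d) (Fin d) ℝ) p.1 p.2 * (y p.1 * y p.2)
        = y ⬝ᵥ y := by
      rw [Fintype.sum_prod_type]
      simp [Matrix.one_apply, dotProduct]
    rw [← sum_outer_mul_outer, ← e, ← Finset.sum_sub_distrib, PiLp.inner_apply]
    refine Finset.sum_congr rfl fun p _ => ?_
    simp only [hY, outerSubOne, RCLike.inner_apply, conj_trivial]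
    ring
  have h2 : inner ℝ Y ((N : ℝ)⁻¹ • ∑ j, outerSubOne (ζ j))
      = (N : ℝ)⁻¹ * ∑ j, (ζ j ⬝ᵥ y) ^ 2 - y ⬝ᵥ y := by
    rw [inner_smul_right, inner_sum]
    simp only [h1, Finset.sum_sub_distrib, Finset.sum_const, Finset.card_univ, Fintype.card_fin,
      nsmul_eq_mul]
    field_simp
  have h3 := (abs_le.mp (abs_real_inner_le_norm Y ((N : ℝ)⁻¹ • ∑ j, outerSubOne (ζ j)))).1
  rw [h2, hYn] at h3
  linarith

/-- With the thresholds of Delage and Ye, the confidence region contains the distribution with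
probability at least `1 - α`. The bounds on the mean and on the second moment fail with
probability at most `α / 2` and `α / 4`. -/
theorem mem_PDY_delageYe (hd : 0 < d) (hN : 0 < N) {a b : Fin d → ℝ} {P : Measure (Fin d → ℝ)}
    [IsProbabilityMeasure P] (h : ∀ᵐ u ∂P, u ∈ Set.Icc a b) (hP : (covMat P).PosDef)
    {α R : ℝ} (hα0 : 0 < α) (hα1 : α < 1)
    (hR : ∀ᵐ u ∂P, (u - meanVec P) ⬝ᵥ ((covMat P)⁻¹ *ᵥ (u - meanVec P)) ≤ R ^ 2)
    (hb : 0 < 1 - beta1 R α N d - beta2 R α N) :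
    ∃ G : Set (Fin N → Fin d → ℝ), MeasurableSet G ∧
      1 - α ≤ (Measure.pi fun _ : Fin N => P).real G ∧
      ∀ x ∈ G, (sampleCov x).PosDef ∧
        P ∈ PDY a b (sampleMean x) (sampleCov x) (gamma1 R α N d) (gamma2 R α N d) := by
  obtain ⟨D, hD⟩ := exists_transpose_mul_self_eq hP.inv.posSemidef
  obtain ⟨z, hz, hzD⟩ := exists_isStandardized h hP hR hD
  have hN' : (0 : ℝ) < N := Nat.cast_pos.mpr hN
  have hL1 : 0 ≤ Real.log (2 / α) := Real.log_nonneg (by rw [le_div_iff₀ hα0]; linarith)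
  have hL2 : 0 ≤ Real.log (4 / α) := Real.log_nonneg (by rw [le_div_iff₀ hα0]; linarith)
  have hp1 := hz.measure_mean_le hd hN hL1
  have hp2 := hz.measure_secondMoment_le hd hN hL2
  rw [Real.exp_neg, Real.exp_log (by positivity), inv_div] at hp1 hp2
  set B₁ : Set (Fin N → Fin d → ℝ) := {x | √(R ^ 2 / N) * (1 + √(2 * Real.log (2 / α)))
    ≤ ‖(N : ℝ)⁻¹ • ∑ j, WithLp.toLp 2 (z (x j))‖} with hB₁
  set B₂ : Set (Fin N → Fin d → ℝ) := {x | R ^ 2 / √N * (√(1 - d / R ^ 4) + √(Real.log (4 / α)))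
    ≤ ‖(N : ℝ)⁻¹ • ∑ j, outerSubOne (z (x j))‖} with hB₂
  set B₃ : Set (Fin N → Fin d → ℝ) := {x | ∀ j, z (x j) = D *ᵥ (x j - meanVec P)} with hB₃
  have hzj : ∀ j, Measurable fun x : Fin N → Fin d → ℝ => z (x j) := fun j =>
    hz.measurable.comp (measurable_pi_apply j)
  have hm1 : MeasurableSet B₁ := by
    have h1 : Measurable fun x : Fin N → Fin d → ℝ => ∑ j, WithLp.toLp 2 (z (x j)) :=
      Finset.measurable_fun_sum _ fun j _ => (WithLp.measurable_toLp 2 _).comp (hzj j)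
    exact measurableSet_le measurable_const (Measurable.const_smul h1 (N : ℝ)⁻¹).norm
  have hm2 : MeasurableSet B₂ := by
    have h1 : Measurable fun x : Fin N → Fin d → ℝ => ∑ j, outerSubOne (z (x j)) :=
      Finset.measurable_fun_sum _ fun j _ => (WithLp.measurable_toLp 2 _).comp
        (measurable_pi_lambda _ fun p => (((measurable_pi_apply p.1).comp (hzj j)).mul
          ((measurable_pi_apply p.2).comp (hzj j))).sub_const _)
    exact measurableSet_le measurable_const (Measurable.const_smul h1 (N : ℝ)⁻¹).norm
  have hm3 : MeasurableSet B₃ := by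
    simp only [hB₃, Set.ofPred_forall]
    refine MeasurableSet.iInter fun j => measurableSet_eq_fun (hzj j) ?_
    exact (by fun_prop : Continuous fun x : Fin N → Fin d → ℝ =>
      D *ᵥ (x j - meanVec P)).measurable
  have h3 : (Measure.pi fun _ : Fin N => P).real B₃ᶜ = 0 := by
    have hae : ∀ᵐ x ∂(Measure.pi fun _ : Fin N => P), ∀ j, z (x j) = D *ᵥ (x j - meanVec P) :=
      ae_all_iff.mpr fun j =>
        (measurePreserving_eval (fun _ : Fin N => P) j).quasiMeasurePreserving.ae hzD
    rw [measureReal_def, show (Measure.pi fun _ : Fin N => P) B₃ᶜ = 0 from hae,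
      ENNReal.toReal_zero]
  refine ⟨(B₁ ∪ B₂ ∪ B₃ᶜ)ᶜ, ((hm1.union hm2).union hm3.compl).compl, ?_, fun x hx => ?_⟩
  · rw [probReal_compl_eq_one_sub ((hm1.union hm2).union hm3.compl)]
    have h4 := measureReal_union_le (μ := Measure.pi fun _ : Fin N => P) (B₁ ∪ B₂) B₃ᶜ
    have h5 := measureReal_union_le (μ := Measure.pi fun _ : Fin N => P) B₁ B₂
    linarith
  · simp only [Set.compl_union, compl_compl, Set.mem_inter_iff, Set.mem_compl_iff] at hx
    obtain ⟨⟨hx1, hx2⟩, hx3⟩ := hx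
    simp only [hB₁, Set.mem_ofPred_eq, not_le] at hx1
    simp only [hB₂, Set.mem_ofPred_eq, not_le] at hx2
    have hx3 : ∀ j, z (x j) = D *ᵥ (x j - meanVec P) := hx3
    have hPdet : IsUnit (covMat P).det := (isUnit_iff_isUnit_det _).mp hP.isUnit
    -- every `l` has the form `Dᵀ y`, and then `lᵀ Σ l = yᵀ y`
    have hl : ∀ l, ∃ y, (∀ u, u ⬝ᵥ l = (D *ᵥ u) ⬝ᵥ y) ∧ l ⬝ᵥ (covMat P *ᵥ l) = y ⬝ᵥ y :=
      fun l => by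
      have e : l = Dᵀ *ᵥ (D *ᵥ (covMat P *ᵥ l)) := by
        rw [mulVec_mulVec, hD, mulVec_mulVec, nonsing_inv_mul _ hPdet, one_mulVec]
      have e2 : ∀ u, u ⬝ᵥ l = (D *ᵥ u) ⬝ᵥ (D *ᵥ (covMat P *ᵥ l)) := fun u => by
        conv_lhs => rw [e]
        rw [dotProduct_mulVec, vecMul_transpose]
      refine ⟨D *ᵥ (covMat P *ᵥ l), e2, ?_⟩
      rw [dotProduct_comm, e2]
    refine mem_PDY_of_concentration hN h hP (by rw [beta2]; positivity) hb (fun l => ?_)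
      fun l => ?_
    · obtain ⟨y, hy, hyy⟩ := hl l
      have h0 : 0 ≤ y ⬝ᵥ y := by rw [← euclNorm_sq]; positivity
      rw [sampleMean_sub_dotProduct hN, hyy]
      simp only [hy, ← hx3]
      refine (sq_mean_dotProduct_le _ y).trans (mul_le_mul_of_nonneg_right ?_ h0)
      refine (pow_le_pow_left₀ (norm_nonneg _) hx1.le 2).trans ?_
      rw [mul_pow, Real.sq_sqrt (by positivity), beta2]
      -- `1 + √(2 log (2 / α))` is less than the `2 + √(2 log (2 / α))` of `beta2`
      gcongr
      norm_num
    · obtain ⟨y, hy, hyy⟩ := hl l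
      have h0 : 0 ≤ y ⬝ᵥ y := by rw [← euclNorm_sq]; positivity
      rw [hyy]
      simp only [hy, ← hx3]
      refine le_trans (mul_le_mul_of_nonneg_right ?_ h0) (le_mean_sq_dotProduct hN _ y)
      rw [beta1]
      linarith

end DY

theorem theorem10 {d N : ℕ} (hN : 0 < N) (a b : Fin d → ℝ)
    (Pstar : Measure (Fin d → ℝ)) [IsProbabilityMeasure Pstar]
    (hsupp : ∀ᵐ u ∂Pstar, u ∈ Set.Icc a b)
    {Ω : Type*} [MeasurableSpace Ω] (Q : Measure Ω) [IsProbabilityMeasure Q]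
    (X : Fin N → Ω → Fin d → ℝ) (hX : ∀ j, Measurable (X j))
    (hlaw : ∀ j, Q.map (X j) = Pstar) (hindep : iIndepFun X Q)
    (α : ℝ) (hα0 : 0 < α) (hα1 : α < 1) :
    -- The guarantee, for any thresholds (possibly computed from the data and from further
    -- randomness, as by the bootstrap) for which the test has level `α`.
    (∀ γ₁ γ₂ : Ω → ℝ, (∀ ω, 0 ≤ γ₁ ω) → (∀ ω, 0 ≤ γ₂ ω) →
      DY.HoldsWithProbAtLeast Q (1 - α) (fun ω =>
        DY.TestAccepts (fun j => X j ω) (γ₁ ω) (γ₂ ω) (DY.meanVec Pstar) (DY.covMat Pstar)) →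
      DY.HoldsWithProbAtLeast Q (1 - α) (fun ω =>
        (DY.sampleCov (fun j => X j ω)).PosDef ∧
        ∀ C : Matrix (Fin d) (Fin d) ℝ, Cᵀ * C = (DY.sampleCov (fun j => X j ω))⁻¹ →
          DY.SimultaneouslyImpliesGuarantee (fun ε =>
            DY.UDY a b (DY.sampleMean (fun j => X j ω)) (DY.sampleCov (fun j => X j ω)) C
              (γ₁ ω) (γ₂ ω) ε) Pstar)) ∧
    -- The guarantee for the explicit thresholds of Delage and Ye, with no condition on the test.
    (∀ R : ℝ, (DY.covMat Pstar).PosDef →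
      (∀ᵐ u ∂Pstar, (u - DY.meanVec Pstar) ⬝ᵥ
        ((DY.covMat Pstar)⁻¹ *ᵥ (u - DY.meanVec Pstar)) ≤ R ^ 2) →
      0 < 1 - DY.beta1 R α N d - DY.beta2 R α N →
      DY.HoldsWithProbAtLeast Q (1 - α) (fun ω =>
        (DY.sampleCov (fun j => X j ω)).PosDef ∧
        ∀ C : Matrix (Fin d) (Fin d) ℝ, Cᵀ * C = (DY.sampleCov (fun j => X j ω))⁻¹ →
          DY.SimultaneouslyImpliesGuarantee (fun ε =>
            DY.UDY a b (DY.sampleMean (fun j => X j ω)) (DY.sampleCov (fun j => X j ω)) C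
              (DY.gamma1 R α N d) (DY.gamma2 R α N d) ε) Pstar)) ∧
    -- For all thresholds: support function = worst-case Value at Risk = value of the program.
    (∀ᵐ ω ∂Q, (DY.sampleCov (fun j => X j ω)).PosDef →
      ∀ C : Matrix (Fin d) (Fin d) ℝ, Cᵀ * C = (DY.sampleCov (fun j => X j ω))⁻¹ →
      ∀ γ₁ γ₂ : ℝ, 0 ≤ γ₁ → 0 ≤ γ₂ → ∀ ε : ℝ, 0 < ε → ε < 1 → ∀ v : Fin d → ℝ,
        ∃ c : ℝ,
          IsLUB ((fun u => v ⬝ᵥ u) '' DY.UDY a b (DY.sampleMean (fun j => X j ω))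
            (DY.sampleCov (fun j => X j ω)) C γ₁ γ₂ ε) c ∧
          IsLUB ((fun P => DY.VaR ε P v) '' DY.PDY a b (DY.sampleMean (fun j => X j ω))
            (DY.sampleCov (fun j => X j ω)) γ₁ γ₂) c ∧
          IsGLB (DY.sdpValues a b (DY.sampleMean (fun j => X j ω))
            (DY.sampleCov (fun j => X j ω)) γ₁ γ₂ ε v) c) := by
  refine ⟨?_, fun R hP hR hb => ?_, ?_⟩
  · rintro γ₁ γ₂ - - ⟨E, hE, hQE, hS⟩
    exact ⟨E, hE, hQE, fun ω hω => ⟨(hS ω hω).1, fun C hC =>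
      DY.simultaneouslyImpliesGuarantee hC (DY.mem_PDY_of_testAccepts hsupp (hS ω hω))⟩⟩
  · rcases Nat.eq_zero_or_pos d with rfl | hd
    · -- in dimension zero `R` may vanish, but all matrices and vectors are equal
      refine ⟨Set.univ, MeasurableSet.univ, ?_, fun ω _ => ⟨?_, fun C hC => ?_⟩⟩
      · rw [measure_univ]
        exact ENNReal.ofReal_le_one.mpr (by linarith)
      · rwa [Subsingleton.elim (DY.sampleCov fun j => X j ω) (DY.covMat Pstar)]
      · refine DY.simultaneouslyImpliesGuarantee hC ⟨inferInstance, hsupp, ?_, ?_⟩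
        · have : 0 ≤ DY.beta2 R α N := by rw [DY.beta2]; positivity
          have h0 : 0 ≤ DY.gamma1 R α N 0 := div_nonneg this hb.le
          simpa using h0
        · rw [Subsingleton.elim (DY.gamma2 R α N 0 • _ - _) (DY.covMat Pstar)]
          exact hP.posSemidef
    · obtain ⟨G, hG, hp, hGS⟩ := DY.mem_PDY_delageYe hd hN hsupp hP hα0 hα1 hR hb
      exact DY.holdsWithProbAtLeast_of_sample hX hlaw hindep hG hp fun ω hω =>
        ⟨(hGS _ hω).1, fun C hC => DY.simultaneouslyImpliesGuarantee hC (hGS _ hω).2⟩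
  · have hbox : ∀ᵐ ω ∂Q, ∀ j, X j ω ∈ Set.Icc a b := ae_all_iff.mpr fun j =>
      ae_of_ae_map (hX j).aemeasurable (by rw [hlaw j]; exact hsupp)
    filter_upwards [hbox] with ω hω hS C hC γ₁ γ₂ hγ₁ hγ₂ ε hε hε1 v
    exact DY.exists_common_value (DY.sampleMean_mem_Icc hN hω) hS hγ₁ hγ₂ hε hε1 hC v
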